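/- Let $\lambda_0,\lambda_1,\lambda_2,\mu,\mu_A,\theta_1,\theta_2>0$, let $g_0=(g_{0,i})_{i\ge 1}$ be a probability distribution on $\mathbb N^*=\{1,2,\dots\}$, and let $\beta=\lambda_0+\mu_A$. **Model.** For a rate $\lambda>0$, a size distribution $g$ on $\mathbb N^*$, and rates $\mu'\ge 0$, $\theta>0$, the queue with parameters $(\lambda,g,\mu',\theta)$ is the continuous-time Markov chain on $\mathbb N$ that jumps from $n$ to $n+k$ ($k\ge1$) at rate $\lambda g_k$ and from $n\ge 1$ to $n-1$ at rate $\mu'+n\theta$. Let $Y$ be the queue with parameters $(\lambda_1,\delta_1,\mu,\theta_1)$ (unit-sized limit and partial market orders at the best quote), so that $Y$ is a birth-and-death chain with birth rate $\lambda_1$ in every state and death rate $\mu+n\theta_1$ in state $n\ge 1$ (none in state $0$). Let $q_{m,n}(t)=\mathbf P(Y(t)=n\mid Y(0)=m)$ and $\hat q_{m,n}(s)=\int_0^\infty e^{-st}q_{m,n}(t)\,dt$. Let $\pi_2=(\pi_{2,i})_{i\ge1}$ be the law of the volume at the next non-empty limit, and $$h_i=\frac{\lambda_0 g_{0,i}}{\lambda_0+\mu_A}+\frac{\mu_A\pi_{2,i}}{\lambda_0+\mu_A},\qquad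 i\ge1 .$$ The volume $X$ at the best quote is the process that evolves as $1+Y$, is killed at rate $\beta$ independently of its position, is restarted instantaneously from a point of $\mathbb N^*$ with law $h$, evolves again as $1+Y$, and so on. **(i) Laplace transforms.** Define $B_0(s)=1$, $B_1(s)=s+\lambda_1$ and $$B_n(s)=(s+\lambda_1+\mu+(n-1)\theta_1)B_{n-1}(s)-\lambda_1(\mu+(n-1)\theta_1)B_{n-2}(s),\quad n\ge2.$$ For $k,l\in\mathbb N$ put $a_1=B_k(s)$, $a_2=-\lambda_1(\mu+(l+1)\theta_1)B_l(s)$, $a_i=-\lambda_1(\mu+(l+i-1)\theta_1)$ for $i\ge3$, $b_1=B_{l+1}(s)$, $b_i=s+\lambda_1+\mu+(l+i-1)\theta_1$ for $i\ge 2$, and $$K_{k,l}(s)=\cfrac{a_1}{b_1+\cfrac{a_2}{b_2+\cfrac{a_3}{b_3+\cdots}}}\ .$$ Then for all $m,n\in\mathbb N$ and $s\in\mathbb C$ with $\operatorname{Re}s>0$, the integral defining $\hat q_{m,n}(s)$ converges absolutely, the continued fraction below converges, and $$\hat q_{m,n}(s)=\lambda_1^{\,n-m}K_{m,n}(s)\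 \ (m\le n),\qquad \hat q_{m,n}(s)=\Big(\prod_{j=n+1}^{m}(\mu+j\theta_1)\Big)K_{n,m}(s)\ \ (m\ge n).$$ **(ii) Stationary distribution.** For every probability distribution $\pi_2$ on $\mathbb N^*$, the process $X$ has exactly one stationary distribution $(\pi_j)_{j\ge1}$, and for every $j\ge1$ $$\pi_j=(\lambda_0+\mu_A)\sum_{m=1}^\infty h_m\,\hat q_{m-1,j-1}(\lambda_0+\mu_A),$$ the series being convergent. **(iii) Model 2a.** The process $1+Y_2$, where $Y_2$ is the queue with parameters $(\lambda_2,\delta_1,0,\theta_2)$ (unit-sized limit orders inside the book), has exactly one stationary distribution $\pi_2$, and with this $\pi_2$, for every $i\ge1$, $$h_i=\frac{\lambda_0g_{0,i}}{\mu_A+\lambda_0}+\frac{\mu_A}{\mu_A+\lambda_0}\,e^{-\lambda_2/\theta_2}\frac{\lambda_2^{\,i-1}}{\theta_2^{\,i-1}(i-1)!}.$$ **(iv) Model 2b.** Let $0<q_2<1$. The process $1+Y_2$, where $Y_2$ is the queue with parameters $(\lambda_2,g_2,0,\theta_2)$ and $g_{2,n}=q_2(1-q_2)^{n-1}$ (geometric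 sizes inside the book), has exactly one stationary distribution $\pi_2$, and with this $\pi_2$ and $r=\frac{\lambda_2}{(1-q_2)\theta_2}$, for every $i\ge1$, $$h_i=\frac{\lambda_0g_{0,i}}{\mu_A+\lambda_0}+\frac{\mu_A}{\mu_A+\lambda_0}\,q_2^{\,r}\,\frac{(1-q_2)^{i-1}}{(i-1)!}\,\frac{\Gamma(i-1+r)}{\Gamma(r)}.$$ -/

import Mathlib

open MeasureTheory Filter Topology
open scoped ENNReal Nat

namespace OrderBook

noncomputable section

/-- A probability distribution on a countable set, given by its weights. -/
def IsDistribution {S : Type} (p : S → ℝ) : Prop :=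
  (∀ i, 0 ≤ p i) ∧ HasSum p 1

/-- All orders are of size one. -/
def unitSize : ℕ+ → ℝ := fun n => if n = 1 then 1 else 0

/-- Geometric order sizes: size `n ≥ 1` has probability `q (1 - q) ^ (n - 1)`. -/
def geometricSize (q : ℝ) : ℕ+ → ℝ := fun n => q * (1 - q) ^ n.natPred

/-! ### Continuous-time Markov chains given by a generator -/

/-- For the continuous-time Markov chain with infinitesimal generator `A`: the probability that,
starting from `i`, the chain makes exactly `n` jumps in `[0, t]` and is at `j` at time `t`.
The chain stays in `i` for an exponential time of parameter `-A i i`, and then moves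
to `k ≠ i` at rate `A i k`; the recursion is on the time `u` of the first jump.
-/
def transitionWithJumps {S : Type} [DecidableEq S] (A : S → S → ℝ) :
    ℕ → ℝ → S → S → ℝ≥0∞
  | 0, t, i, j => if i = j then ENNReal.ofReal (Real.exp (A i i * t)) else 0
  | n + 1, t, i, j =>
      ∫⁻ u in Set.Icc 0 t, ENNReal.ofReal (Real.exp (A i i * u)) *
        ∑' k, if k = i then 0
          else ENNReal.ofReal (A i k) * transitionWithJumps A n (t - u) k j

/-- The transition probabilities `P(Z(t) = j | Z(0) = i)`, `t ≥ 0`, of the continuous-time Markov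
chain `Z` with infinitesimal generator `A` (the minimal transition function of `A`). -/
def transition {S : Type} [DecidableEq S] (A : S → S → ℝ) (t : ℝ) (i j : S) : ℝ≥0∞ :=
  ∑' n, transitionWithJumps A n t i j

/-- `ν` is a stationary distribution of the Markov process with transition probabilities
`P t i j`: a probability distribution such that `ν P(t) = ν` for every `t ≥ 0`. -/
def IsStationary {S : Type} (P : ℝ → S → S → ℝ≥0∞) (ν : S → ℝ) : Prop :=
  IsDistribution ν ∧
    ∀ t : ℝ, 0 ≤ t → ∀ j, ∑' i, ENNReal.ofReal (ν i) * P t i j = ENNReal.ofReal (ν j)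

/-- From the transition probabilities of a process `Z` on `{0, 1, 2, …}` to those of the process
`1 + Z` on `{1, 2, …}`. -/
def onePlus (P : ℝ → ℕ → ℕ → ℝ≥0∞) (t : ℝ) (i j : ℕ+) : ℝ≥0∞ :=
  P t i.natPred j.natPred

/-! ### Queues of standing shares -/

/-- Generator of a queue in which limit orders arrive at rate `lam` with sizes distributed
as `g`, unit-sized market orders arrive at rate `mu` (and have no effect on an empty queue),
and each standing share is cancelled at rate `theta`. -/
def queueGenerator (lam : ℝ) (g : ℕ+ → ℝ) (mu theta : ℝ) (i j : ℕ) : ℝ :=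
  if hij : i < j then lam * g ⟨j - i, Nat.sub_pos_of_lt hij⟩
  else if i = j + 1 then mu + i * theta
  else if i = j then -(lam + if i = 0 then 0 else mu + i * theta)
  else 0

/-- Transition probabilities of `1 + Y₂`, the volume at the next non-empty limit: limit orders at
rate `lam2` with sizes `g2`, cancellation at rate `theta2` per share, no market order; the last
share is never removed. -/
def secondLimitTransition (lam2 : ℝ) (g2 : ℕ+ → ℝ) (theta2 : ℝ) : ℝ → ℕ+ → ℕ+ → ℝ≥0∞ :=
  onePlus (transition (queueGenerator lam2 g2 0 theta2))

/-! ### Killing and resurrecting -/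

/-- Take a (conservative) Markov process with transition probabilities `P`, kill it at an
independent exponential time of parameter `b`, instantaneously restart it from a point with
distribution `h`, and so on. This is the probability that, starting from `i`, exactly `n`
killings occur in `[0, t]` and the process is at `j` at time `t`; the recursion is on the time `u`
of the first killing. -/
def killedTransition {S : Type} (b : ℝ) (h : S → ℝ) (P : ℝ → S → S → ℝ≥0∞) :
    ℕ → ℝ → S → S → ℝ≥0∞
  | 0, t, i, j => ENNReal.ofReal (Real.exp (-b * t)) * P t i j
  | n + 1, t, _, j =>
      ∫⁻ u in Set.Icc 0 t, ENNReal.ofReal (b * Real.exp (-b * u)) *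
        ∑' m, ENNReal.ofReal (h m) * killedTransition b h P n (t - u) m j

/-- Transition probabilities of the killed and resurrected process. -/
def resurrectedTransition {S : Type} (b : ℝ) (h : S → ℝ) (P : ℝ → S → S → ℝ≥0∞)
    (t : ℝ) (i j : S) : ℝ≥0∞ :=
  ∑' n, killedTransition b h P n t i j

/-! ### The volume at the best quote -/

/-- The law `h` of the volume at the best quote just after a price move: with probability
`lam0 / (lam0 + muA)` the size (law `g0`) of a limit order submitted inside the spread, with
probability `muA / (lam0 + muA)` the volume (law `pi2`) at the next non-empty limit. -/
def resetLaw (lam0 muA : ℝ) (g0 pi2 : ℕ+ → ℝ) (i : ℕ+) : ℝ :=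
  lam0 * g0 i / (lam0 + muA) + muA * pi2 i / (lam0 + muA)

/-- Transition probabilities of the volume `X` at the best quote: between price moves it evolves
as `1 + Y`, where `Y` is the queue with limit orders at rate `lam1` with sizes `g1`, unit-sized
partial market orders at rate `mu` and cancellation at rate `theta1` per share; price moves occur
at rate `lam0 + muA` and reset the volume to a point with law `resetLaw`. -/
def bestQuoteTransition (lam0 lam1 mu muA theta1 : ℝ) (g0 g1 pi2 : ℕ+ → ℝ) :
    ℝ → ℕ+ → ℕ+ → ℝ≥0∞ :=
  resurrectedTransition (lam0 + muA) (resetLaw lam0 muA g0 pi2)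
    (onePlus (transition (queueGenerator lam1 g1 mu theta1)))

/-! ### Laplace transforms and continued fractions -/

/-- The integrand of the Laplace transform at `s` of the transition probability from `m` to `n` of
the queue `Y` with unit-sized limit orders. -/
def laplaceIntegrand (lam1 mu theta1 : ℝ) (m n : ℕ) (s : ℂ) (t : ℝ) : ℂ :=
  Complex.exp (-s * t) * ((transition (queueGenerator lam1 unitSize mu theta1) t m n).toReal : ℂ)

/-- The Laplace transform at `s` of the transition probability from `m` to `n` of `Y`. -/
def qHat (lam1 mu theta1 : ℝ) (m n : ℕ) (s : ℂ) : ℂ :=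
  ∫ t in Set.Ioi (0 : ℝ), laplaceIntegrand lam1 mu theta1 m n s t

/-- The sequence `B_n(s)` of the two-step recurrence. -/
def B (lam1 mu theta1 : ℝ) (s : ℂ) : ℕ → ℂ
  | 0 => 1
  | 1 => s + lam1
  | n + 2 => (s + lam1 + mu + ((n : ℂ) + 1) * theta1) * B lam1 mu theta1 s (n + 1)
      - lam1 * (mu + ((n : ℂ) + 1) * theta1) * B lam1 mu theta1 s n

/-- Partial numerators `a_i`, `i ≥ 1` (the value at `i = 0` is not used). -/
def partNum (lam1 mu theta1 : ℝ) (k l : ℕ) (s : ℂ) (i : ℕ) : ℂ :=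
  if i = 1 then B lam1 mu theta1 s k
  else if i = 2 then -lam1 * (mu + ((l : ℂ) + 1) * theta1) * B lam1 mu theta1 s l
  else -lam1 * (mu + ((l : ℂ) + i - 1) * theta1)

/-- Partial denominators `b_i`, `i ≥ 1` (the value at `i = 0` is not used). -/
def partDen (lam1 mu theta1 : ℝ) (l : ℕ) (s : ℂ) (i : ℕ) : ℂ :=
  if i = 1 then B lam1 mu theta1 s (l + 1)
  else s + lam1 + mu + ((l : ℂ) + i - 1) * theta1

/-- The infinite continued fraction `a₁ / (b₁ + a₂ / (b₂ + a₃ / (b₃ + …)))`. -/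
def fraction (lam1 mu theta1 : ℝ) (k l : ℕ) (s : ℂ) : GenContFract ℂ where
  h := 0
  s := Stream'.Seq.ofStream fun i =>
    ⟨partNum lam1 mu theta1 k l s (i + 1), partDen lam1 mu theta1 l s (i + 1)⟩

end

end OrderBook

/-! All transition probabilities are sums over the number of jumps or killings, and each term is an
iterated convolution on `[0, ∞)`. Working in `ℝ≥0∞` makes every exchange of sums and integrals free.

Laplace transforms. For fixed `n`, the column `f m = qHat m n s` is bounded and satisfies the
Laplace transform of the backward Kolmogorov equation, a second-order recurrence in `m` with a
source at `n` (`isResolvent_qHat`). Before the source, `lam ^ m * f m` is a multiple of `B m`; after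
it a second solution `numer` is subtracted (`IsResolvent.pow_mul_add_eq`). The sequences `B` and, up
to a constant factor, `numer` are the denominators and numerators of the continued fraction. Since
`‖B m‖` grows at least like `(lam + Re s) ^ m`, division by `B` turns the boundedness of `f` into
convergence of the convergents to the right value, as in Pincherle's theorem
(`IsResolvent.tendsto_convs`). The case `m ≥ n` follows by reversibility, through a discrete
Wronskian (`IsResolvent.reversible`).

Best quote. The killing times form a Poisson process of rate `b`, so the Erlang densities add up to
the constant `b`. The law at time `t` is therefore the surviving initial part plus `∫ b exp(-b v) (h
P v) dv` over `[0, t]` (`resurrectedTransition_eq`). Letting `t` tend to infinity forces any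
stationary law to be the law of `1 + Y`, started from `h`, at an independent exponential time;
Chapman–Kolmogorov shows that this law is stationary. It is the stated series of Laplace transforms.

Next limit. The Lyapunov function `V i = i` rules out explosion, so a probability distribution is
stationary exactly when it satisfies global balance (`IsBalanced.isStationary`,
`IsStationary.isBalanced`). A queue moves down by single steps only, so balance determines all
weights from the weight at `0`. It remains to check balance for the Poisson and the negative
binomial weights. -/

namespace OrderBook

noncomputable section

/-! ### Convolution on the half-line -/

/-- The convolution of two functions on `[0, ∞)`. -/
def conv (f g : ℝ → ℝ≥0∞) (t : ℝ) : ℝ≥0∞ :=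
  ∫⁻ u in Set.Icc 0 t, f u * g (t - u)

/-- Cutting both factors off to `[0, ∞)` turns the half-line integral into a convolution on the
whole line, from which commutativity and associativity are inherited. -/
theorem conv_eq_lconvolution (f g : ℝ → ℝ≥0∞) :
    conv f g = lconvolution ((Set.Ici 0).indicator f) ((Set.Ici 0).indicator g) volume := by
  ext t
  rw [conv, lconvolution_def, ← lintegral_indicator measurableSet_Icc]
  refine lintegral_congr fun u => ?_
  by_cases h0 : 0 ≤ u <;> by_cases h1 : u ≤ t <;>
    simp [Set.indicator, h0, h1, sub_eq_neg_add]

theorem indicator_conv (f g : ℝ → ℝ≥0∞) : (Set.Ici 0).indicator (conv f g) = conv f g := by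
  ext t
  by_cases h : 0 ≤ t
  · simp [Set.indicator, h]
  · simp [Set.indicator, h, conv]

theorem measurable_conv {f g : ℝ → ℝ≥0∞} (hf : Measurable f) (hg : Measurable g) :
    Measurable (conv f g) := by
  rw [conv_eq_lconvolution]
  exact measurable_lconvolution _ (hf.indicator measurableSet_Ici) (hg.indicator measurableSet_Ici)

theorem conv_comm (f g : ℝ → ℝ≥0∞) : conv f g = conv g f := by
  rw [conv_eq_lconvolution, conv_eq_lconvolution, lconvolution_comm]

theorem conv_left_comm {f g h : ℝ → ℝ≥0∞} (hf : Measurable f) (hg : Measurable g)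
    (hh : Measurable h) : conv f (conv g h) = conv g (conv f h) := by
  have hf' := hf.indicator (measurableSet_Ici (a := (0 : ℝ)))
  have hg' := hg.indicator (measurableSet_Ici (a := (0 : ℝ)))
  have hh' := hh.indicator (measurableSet_Ici (a := (0 : ℝ)))
  rw [conv_eq_lconvolution f, indicator_conv, conv_eq_lconvolution g (conv f h), indicator_conv,
    conv_eq_lconvolution, conv_eq_lconvolution, lconvolution_assoc hf' hg' hh',
    lconvolution_assoc hg' hf' hh', lconvolution_comm (f := (Set.Ici 0).indicator f)
      (g := (Set.Ici 0).indicator g)]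

theorem conv_congr_right (f : ℝ → ℝ≥0∞) {g h : ℝ → ℝ≥0∞} {t : ℝ}
    (H : ∀ v, 0 ≤ v → v ≤ t → g v = h v) : conv f g t = conv f h t :=
  setLIntegral_congr_fun measurableSet_Icc fun u hu => by
    simp only [H (t - u) (by linarith [hu.2]) (by linarith [hu.1])]

theorem conv_mono_right (f : ℝ → ℝ≥0∞) {g h : ℝ → ℝ≥0∞} {t : ℝ}
    (H : ∀ v, 0 ≤ v → v ≤ t → g v ≤ h v) : conv f g t ≤ conv f h t :=
  setLIntegral_mono' measurableSet_Icc fun u hu =>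
    mul_le_mul_right (H (t - u) (by linarith [hu.2]) (by linarith [hu.1])) _

theorem conv_add_right {f g : ℝ → ℝ≥0∞} (h : ℝ → ℝ≥0∞) (hf : Measurable f) (hg : Measurable g)
    (t : ℝ) : conv f (fun v => g v + h v) t = conv f g t + conv f h t := by
  simp only [conv, mul_add]
  exact lintegral_add_left (by fun_prop) _

theorem conv_tsum_right {ι : Type*} [Countable ι] {f : ℝ → ℝ≥0∞} {g : ι → ℝ → ℝ≥0∞}
    (hf : Measurable f) (hg : ∀ i, Measurable (g i)) (t : ℝ) :
    conv f (fun v => ∑' i, g i v) t = ∑' i, conv f (g i) t := by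
  simp only [conv, ← ENNReal.tsum_mul_left]
  exact lintegral_tsum fun i => by have := hg i; fun_prop

theorem conv_sum_right {ι : Type*} {s : Finset ι} {f : ℝ → ℝ≥0∞} {g : ι → ℝ → ℝ≥0∞}
    (hf : Measurable f) (hg : ∀ i ∈ s, Measurable (g i)) (t : ℝ) :
    conv f (fun v => ∑ i ∈ s, g i v) t = ∑ i ∈ s, conv f (g i) t := by
  simp only [conv, Finset.mul_sum]
  exact lintegral_finsetSum' _ fun i hi => by have := hg i hi; fun_prop

theorem conv_const_mul_right {f g : ℝ → ℝ≥0∞} (hf : Measurable f) (hg : Measurable g)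
    (c : ℝ≥0∞) (t : ℝ) : conv f (fun v => c * g v) t = c * conv f g t := by
  simp only [conv, mul_left_comm _ c]
  exact lintegral_const_mul _ (by fun_prop)

theorem lintegral_Icc_ofReal_of_hasDerivAt {F f : ℝ → ℝ} {t : ℝ} (ht : 0 ≤ t)
    (hF : ∀ u, HasDerivAt F (f u) u) (hf : Continuous f) (hf0 : ∀ u, 0 ≤ u → u ≤ t → 0 ≤ f u) :
    ∫⁻ u in Set.Icc 0 t, ENNReal.ofReal (f u) = ENNReal.ofReal (F t - F 0) := by
  rw [← intervalIntegral.integral_eq_sub_of_hasDerivAt (fun u _ => hF u)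
    (hf.intervalIntegrable 0 t), intervalIntegral.integral_of_le ht, ← integral_Icc_eq_integral_Ioc,
    ofReal_integral_eq_lintegral_ofReal]
  · exact hf.integrableOn_Icc
  · filter_upwards [ae_restrict_mem measurableSet_Icc] with u hu using hf0 u hu.1 hu.2

theorem hasDerivAt_exp_mul (a u : ℝ) :
    HasDerivAt (fun u => Real.exp (a * u)) (Real.exp (a * u) * a) u := by
  simpa using ((hasDerivAt_id' u).const_mul a).exp

/-! ### Markov chains -/

section Chain

variable {S : Type}

/-- The probability of staying at least for a time `t` in `i`. -/
def stay (A : S → S → ℝ) (i : S) (t : ℝ) : ℝ≥0∞ := ENNReal.ofReal (Real.exp (A i i * t))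

@[fun_prop]
theorem measurable_stay (A : S → S → ℝ) (i : S) : Measurable (stay A i) := by
  unfold stay; fun_prop

theorem stay_add (A : S → S → ℝ) (i : S) (u v : ℝ) : stay A i (u + v) = stay A i u * stay A i v := by
  rw [stay, stay, stay, ← ENNReal.ofReal_mul (Real.exp_pos _).le, ← Real.exp_add, mul_add]

theorem stay_lt_one (A : S → S → ℝ) (i : S) (hA : A i i < 0) {t : ℝ} (ht : 0 < t) :
    stay A i t < 1 := by
  rw [stay, ENNReal.ofReal_lt_one, Real.exp_lt_one_iff]
  exact mul_neg_of_neg_of_pos hA ht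

theorem stay_le_one (A : S → S → ℝ) (i : S) (hA : A i i < 0) {t : ℝ} (ht : 0 ≤ t) :
    stay A i t ≤ 1 := by
  rw [stay, ENNReal.ofReal_le_one, Real.exp_le_one_iff]
  exact mul_nonpos_of_nonpos_of_nonneg hA.le ht

theorem IsDistribution.tsum_ofReal {ν : S → ℝ} (hν : IsDistribution ν) :
    ∑' i, ENNReal.ofReal (ν i) = 1 := by
  rw [← ENNReal.ofReal_tsum_of_nonneg hν.1 hν.2.summable, hν.2.tsum_eq, ENNReal.ofReal_one]

/-- Memorylessness: the first jump falls either before `v`, or after `v`, in which case the holding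
time starts afresh at `v` at the cost of the factor `stay A i v`. -/
theorem conv_stay_add (A : S → S → ℝ) (i : S) {g : ℝ → ℝ≥0∞} (hg : Measurable g) {v t : ℝ}
    (hv : 0 ≤ v) (ht : 0 ≤ t) :
    conv (stay A i) g (v + t) =
      conv (stay A i) (fun w => g (w + t)) v + stay A i v * conv (stay A i) g t := by
  rw [conv, ← Set.Icc_union_Ioc_eq_Icc hv (by linarith : v ≤ v + t),
    lintegral_union measurableSet_Ioc]
  · congr 1
    · refine setLIntegral_congr_fun measurableSet_Icc fun u hu => ?_
      simp only [add_sub_right_comm]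
    · rw [setLIntegral_congr Ioc_ae_eq_Icc, conv, ← lintegral_const_mul _ (by fun_prop),
        ← lintegral_indicator measurableSet_Icc, ← lintegral_indicator measurableSet_Icc,
        ← lintegral_add_left_eq_self _ v]
      refine lintegral_congr fun u => ?_
      by_cases h0 : 0 ≤ u <;> by_cases h1 : u ≤ t <;>
        simp [Set.indicator, h0, h1, stay_add, mul_assoc]
  · refine Set.disjoint_left.2 fun u hu hu' => ?_
    exact absurd hu'.1 (not_lt.2 hu.2)

theorem conv_stay_const (A : S → S → ℝ) (i : S) (hA : A i i < 0) {t : ℝ} (ht : 0 ≤ t) :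
    conv (stay A i) (fun _ => ENNReal.ofReal (-A i i)) t =
      ENNReal.ofReal (1 - Real.exp (A i i * t)) := by
  have h := lintegral_Icc_ofReal_of_hasDerivAt (F := fun u => -Real.exp (A i i * u))
    (f := fun u => Real.exp (A i i * u) * (-A i i)) ht
    (fun u => by
      rw [mul_neg]
      exact (hasDerivAt_exp_mul (A i i) u).neg) (by fun_prop)
    (fun u _ _ => mul_nonneg (Real.exp_pos _).le (by linarith))
  rw [conv]
  simp only [stay, ← ENNReal.ofReal_mul (Real.exp_pos _).le]
  rw [h]
  congr 1
  simp; ring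

theorem conv_stay_one (A : S → S → ℝ) (i : S) (hA : A i i < 0) {t : ℝ} (ht : 0 ≤ t) :
    ENNReal.ofReal (-A i i) * conv (stay A i) (fun _ => 1) t = 1 - stay A i t := by
  rw [← conv_const_mul_right (by fun_prop) (by fun_prop)]
  simp only [mul_one]
  rw [conv_stay_const A i hA ht, stay, ENNReal.ofReal_sub _ (Real.exp_pos _).le, ENNReal.ofReal_one]

variable [DecidableEq S]

/-- The rate of the jumps from `i` to `k`. -/
def jumpRate (A : S → S → ℝ) (i k : S) : ℝ≥0∞ := if k = i then 0 else ENNReal.ofReal (A i k)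

theorem transitionWithJumps_zero (A : S → S → ℝ) (t : ℝ) (i j : S) :
    transitionWithJumps A 0 t i j = if i = j then stay A i t else 0 := rfl

theorem transitionWithJumps_succ (A : S → S → ℝ) (n : ℕ) (t : ℝ) (i j : S) :
    transitionWithJumps A (n + 1) t i j =
      conv (stay A i) (fun v => ∑' k, jumpRate A i k * transitionWithJumps A n v k j) t := by
  simp only [transitionWithJumps, conv, stay, jumpRate, ite_mul, zero_mul]

variable [Countable S]

@[fun_prop]
theorem measurable_transitionWithJumps (A : S → S → ℝ) (n : ℕ) (i j : S) :
    Measurable fun t => transitionWithJumps A n t i j := by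
  induction n generalizing i with
  | zero => simp only [transitionWithJumps_zero]; split_ifs <;> fun_prop
  | succ n ih =>
    simp only [transitionWithJumps_succ]
    exact measurable_conv (by fun_prop) (Measurable.tsum fun k => (ih k).const_mul _)

@[fun_prop]
theorem measurable_transition (A : S → S → ℝ) (i j : S) :
    Measurable fun t => transition A t i j :=
  Measurable.tsum fun n => measurable_transitionWithJumps A n i j

theorem transitionWithJumps_succ_eq_tsum (A : S → S → ℝ) (n : ℕ) (t : ℝ) (i j : S) :
    transitionWithJumps A (n + 1) t i j =
      ∑' k, jumpRate A i k * conv (stay A i) (fun v => transitionWithJumps A n v k j) t := by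
  rw [transitionWithJumps_succ, conv_tsum_right (by fun_prop) (by fun_prop)]
  exact tsum_congr fun k => conv_const_mul_right (by fun_prop) (by fun_prop) _ _

/-- The recursion on the time of the last jump. -/
theorem transitionWithJumps_succ_forward (A : S → S → ℝ) (n : ℕ) (t : ℝ) (i j : S) :
    transitionWithJumps A (n + 1) t i j =
      ∑' k, jumpRate A k j * conv (stay A j) (fun v => transitionWithJumps A n v i k) t := by
  induction n generalizing t i with
  | zero =>
    -- With a single jump, the landing state must be `j` and the state before the jump must be `i`;
    -- both sides are then the same convolution of two holding factors.
    rw [transitionWithJumps_succ_eq_tsum, tsum_eq_single j, tsum_eq_single i]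
    · simp only [transitionWithJumps_zero, if_true]
      exact congrArg _ (congrFun (conv_comm _ _) t)
    · intro k hk
      simp [transitionWithJumps_zero, hk.symm, conv]
    · intro k hk
      simp [transitionWithJumps_zero, hk, conv]
  | succ n ih =>
    have hm : ∀ k l, Measurable fun v =>
        jumpRate A l j * conv (stay A j) (fun v => transitionWithJumps A n v k l) v := fun k l =>
      (measurable_conv (by fun_prop) (by fun_prop)).const_mul _
    have hm' : ∀ k l, Measurable fun v =>
        jumpRate A i k * conv (stay A i) (fun v => transitionWithJumps A n v k l) v := fun k l =>
      (measurable_conv (by fun_prop) (by fun_prop)).const_mul _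
    rw [transitionWithJumps_succ_eq_tsum]
    simp only [ih]
    calc
      _ = ∑' k, ∑' l, jumpRate A i k * (jumpRate A l j *
            conv (stay A i) (conv (stay A j) (fun v => transitionWithJumps A n v k l)) t) := by
        refine tsum_congr fun k => ?_
        rw [conv_tsum_right (by fun_prop) (hm k), ← ENNReal.tsum_mul_left]
        refine tsum_congr fun l => congrArg _ ?_
        exact conv_const_mul_right (by fun_prop)
          (measurable_conv (by fun_prop) (by fun_prop)) _ _
      _ = ∑' l, ∑' k, jumpRate A i k * (jumpRate A l j *
            conv (stay A i) (conv (stay A j) (fun v => transitionWithJumps A n v k l)) t) :=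
        ENNReal.tsum_comm
      _ = _ := by
        refine tsum_congr fun l => ?_
        simp only [transitionWithJumps_succ_eq_tsum]
        rw [conv_tsum_right (by fun_prop) fun k => hm' k l, ← ENNReal.tsum_mul_left]
        refine tsum_congr fun k => ?_
        rw [mul_left_comm]
        refine congrArg _ ?_
        -- The first and the last holding times are independent, so their convolutions may be taken
        -- in either order.
        rw [conv_left_comm (by fun_prop) (by fun_prop) (by fun_prop)]
        exact (conv_const_mul_right (by fun_prop)
          (measurable_conv (by fun_prop) (by fun_prop)) _ _).symm

/-- The backward integral equation. -/
theorem transition_backward (A : S → S → ℝ) (t : ℝ) (i j : S) :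
    transition A t i j = (if i = j then stay A i t else 0) +
      conv (stay A i) (fun v => ∑' k, jumpRate A i k * transition A v k j) t := by
  rw [transition, tsum_eq_zero_add' ENNReal.summable, transitionWithJumps_zero]
  congr 1
  simp only [transitionWithJumps_succ, transition, ← ENNReal.tsum_mul_left]
  rw [← conv_tsum_right (by fun_prop)
    fun n => Measurable.tsum fun k => (by fun_prop)]
  exact conv_congr_right _ fun v _ _ => ENNReal.tsum_comm

/-- The forward integral equation. -/
theorem transition_forward (A : S → S → ℝ) (t : ℝ) (i j : S) :
    transition A t i j = (if i = j then stay A i t else 0) +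
      ∑' k, jumpRate A k j * conv (stay A j) (fun v => transition A v i k) t := by
  rw [transition, tsum_eq_zero_add' ENNReal.summable, transitionWithJumps_zero]
  congr 1
  simp only [transitionWithJumps_succ_forward]
  rw [ENNReal.tsum_comm]
  refine tsum_congr fun k => ?_
  rw [ENNReal.tsum_mul_left, ← conv_tsum_right (by fun_prop) (by fun_prop)]
  rfl

/-- Chapman–Kolmogorov refined by the number of jumps before and after time `v`. Splitting the
first-jump integral at `v` gives the term with no jump before `v` and, by induction, all the others;
the sums are finite at this level, which makes the induction possible. -/
theorem transitionWithJumps_add (A : S → S → ℝ) (n : ℕ) {v t : ℝ} (hv : 0 ≤ v) (ht : 0 ≤ t)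
    (i j : S) :
    transitionWithJumps A n (v + t) i j = ∑ p ∈ Finset.HasAntidiagonal.antidiagonal n,
      ∑' k, transitionWithJumps A p.1 v i k * transitionWithJumps A p.2 t k j := by
  induction n generalizing v i with
  | zero =>
    simp only [Finset.HasAntidiagonal.antidiagonal_zero, Finset.sum_singleton]
    rw [tsum_eq_single i fun k hk => by simp [transitionWithJumps_zero, hk.symm]]
    by_cases h : i = j <;> simp [transitionWithJumps_zero, h, stay_add]
  | succ n ih =>
    rw [transitionWithJumps_succ, conv_stay_add A i
      (Measurable.tsum fun k => by fun_prop) hv ht, ← transitionWithJumps_succ,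
      Finset.Nat.sum_antidiagonal_succ, add_comm]
    congr 1
    · rw [tsum_eq_single i fun k hk => by simp [transitionWithJumps_zero, hk.symm]]
      simp [transitionWithJumps_zero]
    · simp only [transitionWithJumps_succ]
      have hm : ∀ (m : ℕ) (l : S), Measurable fun w =>
          ∑' k, jumpRate A i k * transitionWithJumps A m w k l := fun m l =>
        Measurable.tsum fun k => by fun_prop
      rw [conv_congr_right (h := fun w => ∑ p ∈ Finset.HasAntidiagonal.antidiagonal n, ∑' l,
        transitionWithJumps A p.2 t l j *
          ∑' k, jumpRate A i k * transitionWithJumps A p.1 w k l), conv_sum_right (by fun_prop)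
            fun p _ => Measurable.tsum fun l => (hm p.1 l).const_mul _]
      · refine Finset.sum_congr rfl fun p _ => ?_
        rw [conv_tsum_right (by fun_prop) fun l => (hm p.1 l).const_mul _]
        refine tsum_congr fun l => ?_
        rw [conv_const_mul_right (by fun_prop) (hm p.1 l), mul_comm]
      · intro w hw _
        simp only [ih hw, Finset.mul_sum]
        rw [Summable.tsum_finsetSum fun _ _ => ENNReal.summable]
        refine Finset.sum_congr rfl fun p _ => ?_
        simp only [← ENNReal.tsum_mul_left]
        rw [ENNReal.tsum_comm]
        exact tsum_congr fun l => tsum_congr fun k => by ring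

theorem tsum_sum_antidiagonal (f : ℕ × ℕ → ℝ≥0∞) :
    ∑' n, ∑ p ∈ Finset.HasAntidiagonal.antidiagonal n, f p = ∑' p, f p := by
  rw [← Finset.HasAntidiagonal.sigmaAntidiagonalEquivProd.tsum_eq, ENNReal.tsum_sigma']
  exact tsum_congr fun n => (Finset.tsum_subtype _ _).symm

/-- The Chapman–Kolmogorov equation. -/
theorem transition_add (A : S → S → ℝ) {v t : ℝ} (hv : 0 ≤ v) (ht : 0 ≤ t) (i j : S) :
    transition A (v + t) i j = ∑' k, transition A v i k * transition A t k j := by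
  simp only [transition, transitionWithJumps_add A _ hv ht]
  rw [tsum_sum_antidiagonal fun p =>
      ∑' k, transitionWithJumps A p.1 v i k * transitionWithJumps A p.2 t k j, ENNReal.tsum_comm]
  refine tsum_congr fun k => ?_
  simp only [ENNReal.tsum_prod', ENNReal.tsum_mul_left, ENNReal.tsum_mul_right]

/-! ### Conservation of mass -/

/-- The rates of the jumps out of every state sum up to the rate of leaving that state. -/
def IsConservative (A : S → S → ℝ) : Prop :=
  ∀ i, ∑' k, jumpRate A i k = ENNReal.ofReal (-A i i) ∧ A i i < 0

/-- The probability of at least `n` jumps up to time `t`. -/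
def tail (A : S → S → ℝ) : ℕ → ℝ → S → ℝ≥0∞
  | 0, _, _ => 1
  | n + 1, t, i => conv (stay A i) (fun v => ∑' k, jumpRate A i k * tail A n v k) t

@[fun_prop]
theorem measurable_tail (A : S → S → ℝ) (n : ℕ) (i : S) : Measurable fun t => tail A n t i := by
  induction n generalizing i with
  | zero => exact measurable_const
  | succ n ih =>
    exact measurable_conv (by fun_prop) (Measurable.tsum fun k => (ih k).const_mul _)

/-- Conditioning on the first jump: by conservation the total rate out of `i` is `-A i i`, so the
inductive identity integrates to `1 - stay`, and `stay` is the term with no jump. -/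
theorem sum_transitionWithJumps_add_tail {A : S → S → ℝ} (hA : IsConservative A) (n : ℕ) {t : ℝ}
    (ht : 0 ≤ t) (i : S) :
    ∑ m ∈ Finset.range n, ∑' j, transitionWithJumps A m t i j + tail A n t i = 1 := by
  induction n generalizing t i with
  | zero => simp [tail]
  | succ n ih =>
    have hm : ∀ m, Measurable fun v =>
        ∑' k, jumpRate A i k * ∑' j, transitionWithJumps A m v k j := fun m =>
      Measurable.tsum fun k => (Measurable.tsum fun j => by fun_prop).const_mul _
    have h0 : ∑' j, transitionWithJumps A 0 t i j = stay A i t := by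
      rw [tsum_eq_single i fun j hj => by simp [transitionWithJumps_zero, hj.symm]]
      simp [transitionWithJumps_zero]
    have h1 : ∀ m, ∑' j, transitionWithJumps A (m + 1) t i j = conv (stay A i) (fun v =>
        ∑' k, jumpRate A i k * ∑' j, transitionWithJumps A m v k j) t := by
      intro m
      simp only [transitionWithJumps_succ]
      rw [← conv_tsum_right (by fun_prop) fun j => Measurable.tsum fun k => by fun_prop]
      refine conv_congr_right _ fun v _ _ => ?_
      rw [ENNReal.tsum_comm]
      simp only [ENNReal.tsum_mul_left]
    rw [Finset.sum_range_succ', h0, add_right_comm]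
    simp only [h1]
    rw [← conv_sum_right (by fun_prop) fun m _ => hm m, tail,
      ← conv_add_right _ (by fun_prop) (Finset.measurable_sum _ fun m _ => hm m),
      conv_congr_right (h := fun _ => ENNReal.ofReal (-A i i)), conv_stay_const A i (hA i).2 ht,
      stay, ← ENNReal.ofReal_add _ (Real.exp_pos _).le]
    · simp
    · simpa using mul_nonpos_of_nonpos_of_nonneg (hA i).2.le ht
    · intro v hv _
      rw [← Summable.tsum_finsetSum fun _ _ => ENNReal.summable,
        ← ENNReal.tsum_add, ← (hA i).1]
      refine tsum_congr fun k => ?_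
      rw [← Finset.mul_sum, ← mul_add, ih hv, mul_one]

/-- A Lyapunov function controlling the expected number of jumps. -/
def IsLyapunov (A : S → S → ℝ) (V : S → ℝ) (c : ℝ) : Prop :=
  0 ≤ c ∧ (∀ i, 0 ≤ V i) ∧ ∀ i, ∑' k, jumpRate A i k * ENNReal.ofReal (1 + V k) ≤
    ENNReal.ofReal (-A i i * V i + c)

/-- The left side is the expected number of jumps up to `t`, truncated at `n`. The Lyapunov
condition says that the generator applied to `V`, plus the total jump rate, is at most `c`; hence
`V` plus the number of jumps minus `c * t` behaves as a supermartingale. The proof is its version by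
first-jump induction. -/
theorem sum_tail_le {A : S → S → ℝ} (hA : IsConservative A) {V : S → ℝ} {c : ℝ}
    (hV : IsLyapunov A V c) (n : ℕ) {t : ℝ} (ht : 0 ≤ t) (i : S) :
    ∑ m ∈ Finset.range n, tail A (m + 1) t i ≤ ENNReal.ofReal (V i + c * t) := by
  obtain ⟨hc, hV0, hV⟩ := hV
  induction n generalizing t i with
  | zero => simp
  | succ n ih =>
    have hm : ∀ m, Measurable fun v => ∑' k, jumpRate A i k * tail A m v k := fun m =>
      Measurable.tsum fun k => by fun_prop
    have hq : 0 ≤ -A i i := by linarith [(hA i).2]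
    calc
      _ = conv (stay A i) (fun v => ∑ m ∈ Finset.range (n + 1),
            ∑' k, jumpRate A i k * tail A m v k) t := by
        rw [conv_sum_right (by fun_prop) fun m _ => hm m]
        rfl
      _ ≤ conv (stay A i) (fun v => ENNReal.ofReal (-A i i * V i + c + -A i i * c * v)) t := by
        refine conv_mono_right _ fun v hv _ => ?_
        rw [← Summable.tsum_finsetSum fun _ _ => ENNReal.summable]
        calc
          _ ≤ ∑' k, (jumpRate A i k * ENNReal.ofReal (1 + V k) +
                jumpRate A i k * ENNReal.ofReal (c * v)) := by
            refine ENNReal.tsum_le_tsum fun k => ?_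
            -- The term `m = 0` equals `1` and counts the first jump itself; the other terms are
            -- bounded by induction from the new state `k`.
            rw [← Finset.mul_sum, ← mul_add, Finset.sum_range_succ', add_comm,
              ENNReal.ofReal_add zero_le_one (hV0 k), add_assoc,
              ← ENNReal.ofReal_add (hV0 k) (by positivity)]
            gcongr
            · simp [tail]
            · exact ih hv k
          _ ≤ _ := by
            rw [ENNReal.tsum_add, ENNReal.tsum_mul_right, (hA i).1, mul_assoc,
              ENNReal.ofReal_add (by have := hV0 i; positivity) (by positivity),
              ENNReal.ofReal_mul hq (q := c * v)]
            gcongr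
            exact hV i
      _ ≤ _ := by
        -- Explicit antiderivative of the bound. The integral is `V i + c * t` minus the nonnegative
        -- term `exp (A i i * t) * V i`, which is dropped.
        have h := lintegral_Icc_ofReal_of_hasDerivAt
          (F := fun u => Real.exp (A i i * u) * -(V i + c * (t - u)))
          (f := fun u => Real.exp (A i i * u) * (-A i i * V i + c + -A i i * c * (t - u))) ht
          (fun u => by
            have h1 := hasDerivAt_exp_mul (A i i) u
            have h2 : HasDerivAt (fun u => -(V i + c * (t - u))) (-(c * -1)) u :=
              ((((hasDerivAt_id u).const_sub t).const_mul c).const_add (V i)).neg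
            refine (h1.mul h2).congr_deriv ?_
            ring) (by fun_prop)
          (fun u _ hu => by
            have := hV0 i
            have : 0 ≤ t - u := by linarith
            positivity)
        rw [conv]
        simp only [stay, ← ENNReal.ofReal_mul (Real.exp_pos _).le]
        rw [h]
        refine ENNReal.ofReal_le_ofReal ?_
        have := mul_nonneg (Real.exp_pos (A i i * t)).le (hV0 i)
        simp only [mul_zero, Real.exp_zero, sub_self, sub_zero]
        linarith

theorem tsum_tail_le {A : S → S → ℝ} (hA : IsConservative A) {V : S → ℝ} {c : ℝ}
    (hV : IsLyapunov A V c) {t : ℝ} (ht : 0 ≤ t) (i : S) :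
    ∑' m, tail A (m + 1) t i ≤ ENNReal.ofReal (V i + c * t) :=
  ENNReal.tsum_le_of_sum_range_le fun n => sum_tail_le hA hV n ht i

/-- A chain with a Lyapunov function does not explode. -/
theorem tsum_transition {A : S → S → ℝ} (hA : IsConservative A) {V : S → ℝ} {c : ℝ}
    (hV : IsLyapunov A V c) {t : ℝ} (ht : 0 ≤ t) (i : S) :
    ∑' j, transition A t i j = 1 := by
  have h0 : Tendsto (fun n => tail A n t i) atTop (𝓝 0) := by
    rw [← tendsto_add_atTop_iff_nat 1]
    exact ENNReal.tendsto_atTop_zero_of_tsum_ne_top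
      ((tsum_tail_le hA hV ht i).trans_lt ENNReal.ofReal_lt_top).ne
  have h1 := (ENNReal.tendsto_nat_tsum fun m => ∑' j, transitionWithJumps A m t i j).add h0
  simp only [sum_transitionWithJumps_add_tail hA _ ht, add_zero] at h1
  unfold transition
  rw [ENNReal.tsum_comm]
  exact tendsto_nhds_unique h1 tendsto_const_nhds

theorem tsum_transition_le_one {A : S → S → ℝ} (hA : IsConservative A) {t : ℝ} (ht : 0 ≤ t)
    (i : S) : ∑' j, transition A t i j ≤ 1 := by
  unfold transition
  rw [ENNReal.tsum_comm]
  refine ENNReal.tsum_le_of_sum_range_le fun n => ?_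
  rw [← sum_transitionWithJumps_add_tail hA n ht i]
  exact le_self_add

theorem transition_le_one {A : S → S → ℝ} (hA : IsConservative A) {t : ℝ} (ht : 0 ≤ t)
    (i j : S) : transition A t i j ≤ 1 :=
  (ENNReal.le_tsum j).trans (tsum_transition_le_one hA ht i)

/-! ### Stationary distributions -/

/-- The global balance equations. -/
def IsBalanced (A : S → S → ℝ) (ν : S → ℝ) : Prop :=
  ∀ j, ∑' k, ENNReal.ofReal (ν k) * jumpRate A k j = ENNReal.ofReal (ν j) * ENNReal.ofReal (-A j j)

/-- A balanced `ν` is subinvariant for the minimal transition function. In the last-jump recursion,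
bounding the law before the last jump by `ν` and applying balance at `j` gives `ν j * (1 - stay)`,
to which the no-jump term `ν j * stay` is added. -/
theorem IsBalanced.sum_le {A : S → S → ℝ} (hA : IsConservative A) {ν : S → ℝ}
    (hν : IsBalanced A ν) (n : ℕ) {t : ℝ} (ht : 0 ≤ t) (j : S) :
    ∑ m ∈ Finset.range n, ∑' i, ENNReal.ofReal (ν i) * transitionWithJumps A m t i j ≤
      ENNReal.ofReal (ν j) := by
  induction n generalizing t j with
  | zero => simp
  | succ n ih =>
    have h0 : ∑' i, ENNReal.ofReal (ν i) * transitionWithJumps A 0 t i j =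
        ENNReal.ofReal (ν j) * stay A j t := by
      rw [tsum_eq_single j fun i hi => by simp [transitionWithJumps_zero, hi]]
      simp [transitionWithJumps_zero]
    have h1 : ∀ m, ∑' i, ENNReal.ofReal (ν i) * transitionWithJumps A (m + 1) t i j =
        ∑' k, jumpRate A k j * conv (stay A j)
          (fun v => ∑' i, ENNReal.ofReal (ν i) * transitionWithJumps A m v i k) t := by
      intro m
      simp only [transitionWithJumps_succ_forward, ← ENNReal.tsum_mul_left]
      rw [ENNReal.tsum_comm]
      refine tsum_congr fun k => ?_
      rw [conv_tsum_right (by fun_prop) (by fun_prop), ← ENNReal.tsum_mul_left]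
      refine tsum_congr fun i => ?_
      rw [conv_const_mul_right (by fun_prop) (by fun_prop), mul_left_comm]
    rw [Finset.sum_range_succ', h0]
    simp only [h1]
    rw [← Summable.tsum_finsetSum fun _ _ => ENNReal.summable]
    calc
      _ ≤ ∑' k, jumpRate A k j * (ENNReal.ofReal (ν k) * conv (stay A j) (fun _ => 1) t) +
          ENNReal.ofReal (ν j) * stay A j t := by
        gcongr with k
        rw [← Finset.mul_sum, ← conv_sum_right (by fun_prop) fun m _ =>
          Measurable.tsum fun i => by fun_prop,
          ← conv_const_mul_right (g := fun _ => 1) (by fun_prop) (by fun_prop)]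
        refine mul_le_mul_right (conv_mono_right _ fun v hv _ => ?_) _
        rw [mul_one]
        exact ih hv k
      _ = ENNReal.ofReal (ν j) := by
        simp only [← mul_assoc]
        rw [ENNReal.tsum_mul_right]
        simp only [mul_comm (jumpRate A _ j)]
        rw [hν j, mul_assoc, conv_stay_one A j (hA j).2 ht, ← mul_add,
          tsub_add_cancel_of_le (stay_le_one A j (hA j).2 ht), mul_one]

/-- Subinvariance holds state by state. Without explosion both sides have total mass `1`, so strict
inequality at a single state is impossible. -/
theorem IsBalanced.isStationary {A : S → S → ℝ} (hA : IsConservative A) {V : S → ℝ} {c : ℝ}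
    (hV : IsLyapunov A V c) {ν : S → ℝ} (hν : IsDistribution ν) (hb : IsBalanced A ν) :
    IsStationary (transition A) ν := by
  refine ⟨hν, fun t ht => ?_⟩
  have hle : ∀ j, ∑' i, ENNReal.ofReal (ν i) * transition A t i j ≤ ENNReal.ofReal (ν j) := by
    intro j
    simp only [transition, ← ENNReal.tsum_mul_left]
    rw [ENNReal.tsum_comm]
    exact ENNReal.tsum_le_of_sum_range_le fun n => hb.sum_le hA n ht j
  have hsum : ∑' j, ∑' i, ENNReal.ofReal (ν i) * transition A t i j = 1 := by
    rw [ENNReal.tsum_comm]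
    simp only [ENNReal.tsum_mul_left, tsum_transition hA hV ht, mul_one]
    exact hν.tsum_ofReal
  intro j
  refine (hle j).antisymm (not_lt.1 fun hlt => ?_)
  have := ENNReal.tsum_lt_tsum (hsum ▸ ENNReal.one_ne_top) hle hlt
  rw [hsum, hν.tsum_ofReal] at this
  exact lt_irrefl _ this

/-- Summing the forward integral equation at time `1` against `ν` removes the time dependence inside
the convolution, since `ν` is invariant at every intermediate time. What remains is `ν j * (1 -
stay) = inflow * C` with `-A j j * C = 1 - stay`. -/
theorem IsStationary.isBalanced {A : S → S → ℝ} (hA : IsConservative A) {ν : S → ℝ}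
    (hν : IsStationary (transition A) ν) : IsBalanced A ν := by
  intro j
  have h : ENNReal.ofReal (ν j) = ENNReal.ofReal (ν j) * stay A j 1 +
      (∑' k, ENNReal.ofReal (ν k) * jumpRate A k j) * conv (stay A j) (fun _ => 1) 1 := by
    conv_lhs => rw [← hν.2 1 zero_le_one j]
    simp only [transition_forward A 1, mul_add]
    rw [ENNReal.tsum_add, tsum_eq_single j fun i hi => by simp [hi], if_pos rfl]
    congr 1
    simp only [← ENNReal.tsum_mul_left]
    rw [ENNReal.tsum_comm, ← ENNReal.tsum_mul_right]
    refine tsum_congr fun k => ?_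
    simp only [mul_left_comm (ENNReal.ofReal (ν _)) (jumpRate A k j)]
    rw [ENNReal.tsum_mul_left, mul_comm (ENNReal.ofReal (ν k)), mul_assoc,
      ← conv_const_mul_right (by fun_prop) (by fun_prop)]
    congr 1
    simp only [← conv_const_mul_right (measurable_stay A j) (measurable_transition A _ k)]
    rw [← conv_tsum_right (by fun_prop) (by fun_prop)]
    refine conv_congr_right _ fun v hv _ => ?_
    rw [hν.2 v hv k, mul_one]
  have h1 := conv_stay_one A j (hA j).2 zero_le_one
  have hs := stay_lt_one A j (hA j).2 zero_lt_one
  set x := stay A j 1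
  set C := conv (stay A j) (fun _ => 1) 1
  -- The factor `C` has to be nonzero and finite to be cancelled in `ℝ≥0∞`.
  have hx : 1 - x ≠ 0 := (tsub_pos_of_lt hs).ne'
  have hx' : 1 - x ≠ ⊤ := ENNReal.sub_ne_top ENNReal.one_ne_top
  have hC : C ≠ 0 := fun h0 => hx (by rw [← h1, h0, mul_zero])
  have hC' : C ≠ ⊤ := by
    intro h0
    rw [h0, ENNReal.mul_top (by simpa using (hA j).2)] at h1
    exact hx' h1.symm
  rw [← ENNReal.mul_left_inj hC hC', mul_assoc, h1, ENNReal.mul_sub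
    (fun _ _ => ENNReal.ofReal_ne_top), mul_one]
  refine (ENNReal.sub_eq_of_eq_add (ENNReal.mul_ne_top ENNReal.ofReal_ne_top hs.ne_top) ?_).symm
  rw [add_comm]
  exact h

end Chain

/-! ### The balance equations of a queue -/

theorem tsum_pnat (f : ℕ+ → ℝ≥0∞) : ∑' i, f i = ∑' n : ℕ, f n.succPNat :=
  (Equiv.pnatEquivNat.symm.tsum_eq f).symm

theorem forall_pnat_iff {p : ℕ+ → Prop} : (∀ i, p i) ↔ ∀ n : ℕ, p n.succPNat :=
  ⟨fun h n => h _, fun h i => by simpa using h i.natPred⟩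

section Queue

variable {lam mu theta : ℝ} {g : ℕ+ → ℝ}

theorem queueGenerator_self (lam : ℝ) (g : ℕ+ → ℝ) (mu theta : ℝ) (i : ℕ) :
    queueGenerator lam g mu theta i i = -(lam + if i = 0 then 0 else mu + i * theta) := by
  simp [queueGenerator]

theorem queueGenerator_succ (lam : ℝ) (g : ℕ+ → ℝ) (mu theta : ℝ) (i : ℕ) :
    queueGenerator lam g mu theta (i + 1) i = mu + (i + 1) * theta := by
  simp [queueGenerator]

theorem queueGenerator_add (lam : ℝ) (g : ℕ+ → ℝ) (mu theta : ℝ) (i n : ℕ) :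
    queueGenerator lam g mu theta i (i + 1 + n) = lam * g n.succPNat := by
  have h : i < i + 1 + n := by omega
  rw [queueGenerator, dif_pos h]
  congr 2
  refine PNat.eq ?_
  simp only [PNat.mk_coe, Nat.succPNat_coe]
  omega

theorem queueGenerator_of_add_one_lt (lam : ℝ) (g : ℕ+ → ℝ) (mu theta : ℝ) {i j : ℕ}
    (h : j + 1 < i) : queueGenerator lam g mu theta i j = 0 := by
  rw [queueGenerator, dif_neg (by omega), if_neg (by omega), if_neg (by omega)]

theorem queueGenerator_self_neg (hlam : 0 < lam) (hmu : 0 ≤ mu) (htheta : 0 < theta) (i : ℕ) :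
    queueGenerator lam g mu theta i i < 0 := by
  rw [queueGenerator_self]
  split_ifs <;> [skip; have : 0 ≤ mu + i * theta := (by positivity)] <;> linarith

/-- The expected value of a function after a jump. -/
theorem tsum_jumpRate_queueGenerator (lam : ℝ) (g : ℕ+ → ℝ) (mu theta : ℝ) (f : ℕ → ℝ≥0∞) (i : ℕ) :
    ∑' k, jumpRate (queueGenerator lam g mu theta) i k * f k =
      (if i = 0 then 0 else ENNReal.ofReal (mu + i * theta) * f (i - 1)) +
        ∑' n : ℕ, ENNReal.ofReal (lam * g n.succPNat) * f (i + 1 + n) := by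
  rw [← Summable.sum_add_tsum_nat_add' (k := i + 1) ENNReal.summable]
  congr 1
  · cases i with
    | zero => simp [jumpRate]
    | succ i =>
      rw [Finset.sum_range_succ, Finset.sum_range_succ, Finset.sum_eq_zero]
      · simp [jumpRate, queueGenerator_succ]
      · intro k hk
        rw [jumpRate, queueGenerator_of_add_one_lt _ _ _ _ (by simpa using hk)]
        simp
  · refine tsum_congr fun n => ?_
    rw [jumpRate, add_comm n, if_neg (by omega), queueGenerator_add]

theorem tsum_mul_jumpRate_queueGenerator (lam : ℝ) (g : ℕ+ → ℝ) (mu theta : ℝ) (f : ℕ → ℝ≥0∞)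
    (j : ℕ) :
    ∑' k, f k * jumpRate (queueGenerator lam g mu theta) k j =
      f (j + 1) * ENNReal.ofReal (mu + (j + 1) * theta) +
        ∑ k ∈ Finset.range j, f k * ENNReal.ofReal (queueGenerator lam g mu theta k j) := by
  rw [tsum_eq_sum (s := Finset.range (j + 2)), Finset.sum_range_succ, Finset.sum_range_succ]
  · rw [add_comm]
    congr 1
    · simp [jumpRate, queueGenerator_succ]
    · simp only [jumpRate, if_true, mul_zero, add_zero]
      refine Finset.sum_congr rfl fun k hk => ?_
      rw [if_neg (by simp at hk; omega)]
  · intro k hk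
    rw [jumpRate, queueGenerator_of_add_one_lt _ _ _ _ (by simp at hk; omega)]
    simp

theorem tsum_ofReal_mul_succPNat (hlam : 0 < lam) (hg : IsDistribution g) :
    ∑' n : ℕ, ENNReal.ofReal (lam * g n.succPNat) = ENNReal.ofReal lam := by
  simp only [ENNReal.ofReal_mul hlam.le]
  rw [ENNReal.tsum_mul_left, ← tsum_pnat fun n => ENNReal.ofReal (g n), hg.tsum_ofReal, mul_one]

theorem isConservative_queueGenerator (hlam : 0 < lam) (hmu : 0 ≤ mu) (htheta : 0 < theta)
    (hg : IsDistribution g) : IsConservative (queueGenerator lam g mu theta) := by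
  refine fun i => ⟨?_, queueGenerator_self_neg hlam hmu htheta i⟩
  have := tsum_jumpRate_queueGenerator lam g mu theta (fun _ => 1) i
  simp only [mul_one] at this
  rw [this, tsum_ofReal_mul_succPNat hlam hg, queueGenerator_self, neg_neg]
  split_ifs
  · simp
  · rw [ENNReal.ofReal_add hlam.le (by positivity), add_comm]

/-- With `V i = i`, every departure lowers `V` by one and counts as one jump, so the unbounded
departure rates cancel. Arrivals contribute `lam` times one plus the mean size, which is the
constant `c`; here the finite mean is needed. -/
theorem isLyapunov_queueGenerator (hlam : 0 < lam) (hmu : 0 ≤ mu) (htheta : 0 < theta)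
    (hg : IsDistribution g) (hm : Summable fun n : ℕ+ => (n : ℝ) * g n) :
    IsLyapunov (queueGenerator lam g mu theta) (fun i => i) (lam * (1 + ∑' n : ℕ+, (n : ℝ) * g n)) := by
  have hm0 : 0 ≤ ∑' n : ℕ+, (n : ℝ) * g n :=
    tsum_nonneg fun n => mul_nonneg (Nat.cast_nonneg _) (hg.1 n)
  refine ⟨by positivity, fun i => Nat.cast_nonneg i, fun i => ?_⟩
  have h : ∑' n : ℕ, ENNReal.ofReal (lam * g n.succPNat) *
      ENNReal.ofReal (1 + ((i + 1 + n : ℕ) : ℝ)) =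
        ENNReal.ofReal (lam * (1 + i) + lam * ∑' n : ℕ+, (n : ℝ) * g n) := by
    rw [ENNReal.ofReal_add (by positivity) (by positivity), ENNReal.ofReal_mul hlam.le (q := tsum _),
      ENNReal.ofReal_tsum_of_nonneg (fun n => mul_nonneg (Nat.cast_nonneg _) (hg.1 n)) hm,
      tsum_pnat, ENNReal.ofReal_mul hlam.le, ← tsum_ofReal_mul_succPNat hlam hg,
      ← ENNReal.tsum_mul_right, tsum_ofReal_mul_succPNat hlam hg, ← ENNReal.tsum_mul_left,
      ← ENNReal.tsum_add]
    refine tsum_congr fun n => ?_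
    have hgn := hg.1 n.succPNat
    rw [← ENNReal.ofReal_mul (by positivity), ← ENNReal.ofReal_mul (by positivity),
      ← ENNReal.ofReal_mul (by positivity), ← ENNReal.ofReal_add (by positivity) (by positivity)]
    congr 1
    simp only [Nat.succPNat_coe]
    push_cast
    ring
  rw [tsum_jumpRate_queueGenerator, h, queueGenerator_self, neg_neg]
  split_ifs with h0
  · simp [h0]
    refine le_of_eq ?_
    congr 1
    ring
  · have h1 : 1 ≤ i := Nat.one_le_iff_ne_zero.2 h0
    rw [← ENNReal.ofReal_mul (by positivity), ← ENNReal.ofReal_add _ (by positivity)]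
    · push_cast [h1]
      refine le_of_eq ?_
      congr 1
      ring
    · push_cast [h1]
      have : (0 : ℝ) ≤ i := Nat.cast_nonneg i
      have : 0 ≤ mu + i * theta := by positivity
      refine mul_nonneg this (by linarith)

theorem queueGenerator_nonneg_of_lt (hlam : 0 < lam) (hg : IsDistribution g) {k j : ℕ} (h : k < j) :
    0 ≤ queueGenerator lam g mu theta k j := by
  rw [queueGenerator, dif_pos h]
  exact mul_nonneg hlam.le (hg.1 _)

/-- Only the states below `j` and the state `j + 1` lead into `j`, so the balance equations are
finite sums of nonnegative terms and can be read in `ℝ`. -/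
theorem isBalanced_queueGenerator_iff (hlam : 0 < lam) (hmu : 0 ≤ mu) (htheta : 0 < theta)
    (hg : IsDistribution g) {ν : ℕ → ℝ} (hν : ∀ i, 0 ≤ ν i) :
    IsBalanced (queueGenerator lam g mu theta) ν ↔ ∀ j : ℕ,
      ν (j + 1) * (mu + (j + 1) * theta) +
        ∑ k ∈ Finset.range j, ν k * queueGenerator lam g mu theta k j =
          ν j * -queueGenerator lam g mu theta j j := by
  refine forall_congr' fun j => ?_
  have h1 := hν (j + 1)
  have h2 := hν j
  have h3 := (queueGenerator_self_neg (g := g) hlam hmu htheta j).le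
  have h4 : ∀ k ∈ Finset.range j, 0 ≤ ν k * queueGenerator lam g mu theta k j := fun k hk =>
    mul_nonneg (hν k) (queueGenerator_nonneg_of_lt hlam hg (Finset.mem_range.1 hk))
  have h5 : ∑ k ∈ Finset.range j,
      ENNReal.ofReal (ν k) * ENNReal.ofReal (queueGenerator lam g mu theta k j) =
        ENNReal.ofReal (∑ k ∈ Finset.range j, ν k * queueGenerator lam g mu theta k j) := by
    rw [ENNReal.ofReal_sum_of_nonneg h4]
    exact Finset.sum_congr rfl fun k _ => (ENNReal.ofReal_mul (hν k)).symm
  rw [tsum_mul_jumpRate_queueGenerator, h5, ← ENNReal.ofReal_mul h1, ← ENNReal.ofReal_mul h2,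
    ← ENNReal.ofReal_add (by positivity) (Finset.sum_nonneg h4), ENNReal.ofReal_eq_ofReal_iff]
  · exact add_nonneg (by positivity) (Finset.sum_nonneg h4)
  · exact mul_nonneg h2 (by linarith)

/-- The equation at `j` expresses the weight at `j + 1` through the weights up to `j`. Two solutions
are therefore proportional, and normalization makes them equal. -/
theorem IsBalanced.eq_of_queueGenerator (hlam : 0 < lam) (hmu : 0 ≤ mu) (htheta : 0 < theta)
    (hg : IsDistribution g) {ν π : ℕ → ℝ} (hν : IsDistribution ν) (hπ : IsDistribution π)
    (hbν : IsBalanced (queueGenerator lam g mu theta) ν)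
    (hbπ : IsBalanced (queueGenerator lam g mu theta) π) : ν = π := by
  rw [isBalanced_queueGenerator_iff hlam hmu htheta hg hν.1] at hbν
  rw [isBalanced_queueGenerator_iff hlam hmu htheta hg hπ.1] at hbπ
  -- Proportionality in cross-multiplied form, as the weights at `0` are not yet known to be
  -- nonzero.
  have key : ∀ j, ν j * π 0 = π j * ν 0 := by
    intro j
    induction j using Nat.strong_induction_on with
    | _ j ih =>
      cases j with
      | zero => ring
      | succ j =>
        have hr : mu + (j + 1) * theta ≠ 0 := by positivity
        have h1 : ν (j + 1) * (mu + (j + 1) * theta) = ν j * -queueGenerator lam g mu theta j j -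
          ∑ k ∈ Finset.range j, ν k * queueGenerator lam g mu theta k j := by linarith [hbν j]
        have h2 : π (j + 1) * (mu + (j + 1) * theta) = π j * -queueGenerator lam g mu theta j j -
          ∑ k ∈ Finset.range j, π k * queueGenerator lam g mu theta k j := by linarith [hbπ j]
        have h3 : (∑ k ∈ Finset.range j, ν k * queueGenerator lam g mu theta k j) * π 0 =
            (∑ k ∈ Finset.range j, π k * queueGenerator lam g mu theta k j) * ν 0 := by
          rw [Finset.sum_mul, Finset.sum_mul]
          refine Finset.sum_congr rfl fun k hk => ?_
          rw [mul_right_comm, ih k (by simp at hk; omega), mul_right_comm]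
        refine mul_right_cancel₀ hr ?_
        rw [mul_right_comm, h1, mul_right_comm, h2, sub_mul, sub_mul, h3, mul_right_comm,
          ih j (by omega), mul_right_comm]
  have h0 : π 0 = ν 0 := by
    have h1 := hν.2.mul_right (π 0)
    have h2 := hπ.2.mul_right (ν 0)
    rw [one_mul] at h1 h2
    simp only [key] at h1
    exact h1.unique h2
  have hpos : ν 0 ≠ 0 := by
    intro h
    have hz : ∀ j, ν j = 0 := by
      intro j
      induction j using Nat.strong_induction_on with
      | _ j ih =>
        cases j with
        | zero => exact h
        | succ j =>
          have := hbν j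
          rw [ih j (by omega), Finset.sum_eq_zero fun k hk => by
            rw [ih k (by simp at hk; omega), zero_mul], zero_mul, add_zero] at this
          exact (mul_eq_zero.1 this).resolve_right (by positivity)
    have := hν.2
    rw [show ν = fun _ => 0 from funext hz] at this
    exact zero_ne_one (hasSum_zero.unique this)
  funext j
  exact mul_right_cancel₀ hpos (h0 ▸ key j)

theorem isStationary_queue_iff (hlam : 0 < lam) (hmu : 0 ≤ mu) (htheta : 0 < theta)
    (hg : IsDistribution g) (hm : Summable fun n : ℕ+ => (n : ℝ) * g n) {π : ℕ → ℝ}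
    (hπ : IsDistribution π) (hb : IsBalanced (queueGenerator lam g mu theta) π) (ν : ℕ → ℝ) :
    IsStationary (transition (queueGenerator lam g mu theta)) ν ↔ ν = π := by
  have hc := isConservative_queueGenerator hlam hmu htheta hg
  refine ⟨fun h => (h.isBalanced hc).eq_of_queueGenerator hlam hmu htheta hg h.1 hπ hb, ?_⟩
  rintro rfl
  exact hb.isStationary hc (isLyapunov_queueGenerator hlam hmu htheta hg hm) hπ

theorem isDistribution_natPred_iff {ν : ℕ+ → ℝ} :
    IsDistribution (fun n : ℕ => ν n.succPNat) ↔ IsDistribution ν := by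
  refine and_congr (forall_pnat_iff (p := fun i => 0 ≤ ν i)).symm ?_
  exact Equiv.pnatEquivNat.symm.hasSum_iff

theorem isStationary_onePlus_iff (P : ℝ → ℕ → ℕ → ℝ≥0∞) (ν : ℕ+ → ℝ) :
    IsStationary (onePlus P) ν ↔ IsStationary P (fun n => ν n.succPNat) := by
  refine and_congr isDistribution_natPred_iff.symm (forall₂_congr fun t _ => ?_)
  rw [forall_pnat_iff]
  simp only [tsum_pnat, onePlus, Nat.natPred_succPNat]

/-- The stationary distribution of the volume at the next non-empty limit. -/
theorem isStationary_secondLimit_iff (hlam : 0 < lam) (htheta : 0 < theta)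
    (hg : IsDistribution g) (hm : Summable fun n : ℕ+ => (n : ℝ) * g n) {π : ℕ → ℝ}
    (hπ : IsDistribution π) (hb : ∀ j : ℕ,
      π (j + 1) * (0 + (j + 1) * theta) +
        ∑ k ∈ Finset.range j, π k * queueGenerator lam g 0 theta k j =
          π j * -queueGenerator lam g 0 theta j j) (ν : ℕ+ → ℝ) :
    IsStationary (secondLimitTransition lam g theta) ν ↔ ν = fun i => π i.natPred := by
  rw [secondLimitTransition, isStationary_onePlus_iff, isStationary_queue_iff hlam le_rfl htheta hg
    hm hπ ((isBalanced_queueGenerator_iff hlam le_rfl htheta hg hπ.1).2 hb)]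
  rw [funext_iff, funext_iff, forall_pnat_iff]
  simp

/-! ### Unit sizes -/

theorem unitSize_succPNat (n : ℕ) : unitSize n.succPNat = if n = 0 then 1 else 0 := by
  rw [unitSize]
  refine if_congr ?_ rfl rfl
  rw [← PNat.coe_inj]
  simp

theorem isDistribution_unitSize : IsDistribution unitSize :=
  ⟨fun i => by unfold unitSize; split_ifs <;> norm_num, hasSum_ite_eq 1 1⟩

theorem summable_mul_unitSize : Summable fun n : ℕ+ => (n : ℝ) * unitSize n :=
  summable_of_ne_finset_zero (s := {1}) fun n hn => by
    rw [Finset.mem_singleton] at hn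
    simp [unitSize, hn]

theorem queueGenerator_unitSize_succ (lam mu theta : ℝ) (j : ℕ) :
    queueGenerator lam unitSize mu theta j (j + 1) = lam := by
  have := queueGenerator_add lam unitSize mu theta j 0
  simpa [unitSize_succPNat] using this

theorem queueGenerator_unitSize_of_add_one_lt (lam mu theta : ℝ) {k j : ℕ} (h : k + 1 < j) :
    queueGenerator lam unitSize mu theta k j = 0 := by
  obtain ⟨n, rfl⟩ := Nat.exists_eq_add_of_lt h
  have := queueGenerator_add lam unitSize mu theta k (n + 1)
  rw [show k + 1 + (n + 1) = k + 1 + n + 1 by ring] at this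
  rw [this]
  simp [unitSize_succPNat]

/-- The Poisson weights. -/
def poissonWeight (r : ℝ) (n : ℕ) : ℝ := Real.exp (-r) * (r ^ n / n !)

theorem isDistribution_poissonWeight {r : ℝ} (hr : 0 < r) : IsDistribution (poissonWeight r) := by
  refine ⟨fun n => by unfold poissonWeight; positivity, ?_⟩
  have := (NormedSpace.expSeries_div_hasSum_exp r).mul_left (Real.exp (-r))
  rw [← Real.exp_eq_exp_ℝ, ← Real.exp_add, neg_add_cancel, Real.exp_zero] at this
  exact this

theorem poissonWeight_succ (r : ℝ) (n : ℕ) :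
    poissonWeight r (n + 1) * (n + 1) = poissonWeight r n * r := by
  have : (n ! : ℝ) ≠ 0 := by positivity
  simp only [poissonWeight, Nat.factorial_succ, pow_succ]
  push_cast
  field_simp

/-- The Poisson weights satisfy detailed balance across each edge `n`, `n + 1`; adding the two edges
at `j` gives global balance. -/
theorem isStationary_secondLimit_unitSize_iff (hlam : 0 < lam) (htheta : 0 < theta) (ν : ℕ+ → ℝ) :
    IsStationary (secondLimitTransition lam unitSize theta) ν ↔
      ν = fun i => poissonWeight (lam / theta) i.natPred := by
  refine isStationary_secondLimit_iff hlam htheta isDistribution_unitSize summable_mul_unitSize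
    (isDistribution_poissonWeight (by positivity)) (fun j => ?_) ν
  have h : ∀ n, poissonWeight (lam / theta) (n + 1) * ((n + 1) * theta) =
      poissonWeight (lam / theta) n * lam := by
    intro n
    rw [← mul_assoc, poissonWeight_succ]
    field_simp
  rw [zero_add, h, queueGenerator_self]
  cases j with
  | zero => simp
  | succ j =>
    rw [Finset.sum_range_succ, Finset.sum_eq_zero, queueGenerator_unitSize_succ, ← h j, if_neg j.succ_ne_zero]
    · push_cast
      ring
    · intro k hk
      rw [queueGenerator_unitSize_of_add_one_lt _ _ _ (by simp at hk; omega), mul_zero]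

/-! ### Geometric sizes -/

theorem geometricSize_succPNat (q : ℝ) (n : ℕ) :
    geometricSize q n.succPNat = q * (1 - q) ^ n := by
  simp [geometricSize]

theorem isDistribution_geometricSize {q : ℝ} (hq : 0 < q) (hq1 : q < 1) :
    IsDistribution (geometricSize q) := by
  rw [← isDistribution_natPred_iff]
  simp only [geometricSize_succPNat]
  have h1 : 0 ≤ 1 - q := by linarith
  refine ⟨fun n => by positivity, ?_⟩
  have := (hasSum_geometric_of_lt_one h1 (by linarith)).mul_left q
  rwa [sub_sub_cancel, mul_inv_cancel₀ hq.ne'] at this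

theorem summable_mul_geometricSize {q : ℝ} (hq : 0 < q) (hq1 : q < 1) :
    Summable fun n : ℕ+ => (n : ℝ) * geometricSize q n := by
  rw [← Equiv.pnatEquivNat.symm.summable_iff]
  have h1 : ‖1 - q‖ < 1 := by rw [Real.norm_eq_abs, abs_lt]; constructor <;> linarith
  have h2 := ((hasSum_coe_mul_geometric_of_norm_lt_one h1).summable.add
    (hasSum_geometric_of_norm_lt_one h1).summable).mul_left q
  refine h2.congr fun n => ?_
  change _ = ((n.succPNat : ℕ) : ℝ) * geometricSize q n.succPNat
  rw [geometricSize_succPNat, Nat.succPNat_coe]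
  push_cast
  ring

/-- The weights of the negative binomial distribution. -/
def negBinomialWeight (q r : ℝ) (n : ℕ) : ℝ :=
  q ^ r * ((1 - q) ^ n / n !) * (Real.Gamma (n + r) / Real.Gamma r)

theorem negBinomialWeight_succ (q : ℝ) {r : ℝ} (hr : 0 < r) (n : ℕ) :
    negBinomialWeight q r (n + 1) * (n + 1) = negBinomialWeight q r n * ((1 - q) * (n + r)) := by
  have h1 : (n ! : ℝ) ≠ 0 := by positivity
  have h2 : Real.Gamma ((n + 1 : ℕ) + r) = (n + r) * Real.Gamma (n + r) := by
    rw [← Real.Gamma_add_one (by positivity)]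
    push_cast
    ring_nf
  simp only [negBinomialWeight, h2, Nat.factorial_succ, pow_succ]
  push_cast
  field_simp

/-- Both sides are the rising factorial `r (r + 1) ⋯ (r + n - 1)` divided by `n !`. -/
theorem choose_add_sub_one_eq {r : ℝ} (hr : 0 < r) (n : ℕ) :
    Ring.choose (r + n - 1) n = Real.Gamma (n + r) / Real.Gamma r / n ! := by
  rw [← Ring.multichoose_eq, eq_div_iff (by positivity), mul_comm, ← nsmul_eq_mul,
    Ring.factorial_nsmul_multichoose_eq_ascPochhammer, Polynomial.ascPochhammer_smeval_eq_eval,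
    eq_div_iff (Real.Gamma_pos_of_pos hr).ne']
  induction n with
  | zero => simp
  | succ n ih =>
    rw [ascPochhammer_succ_eval, mul_right_comm, ih, Nat.cast_add_one, add_right_comm,
      Real.Gamma_add_one (by positivity)]
    ring

/-- The total mass is `q ^ r` times the binomial series of `(1 - x) ^ (-r)` at `x = 1 - q`. -/
theorem isDistribution_negBinomialWeight {q r : ℝ} (hq : 0 < q) (hq1 : q < 1) (hr : 0 < r) :
    IsDistribution (negBinomialWeight q r) := by
  have h1 : 0 ≤ 1 - q := by linarith
  have hG : 0 < Real.Gamma r := Real.Gamma_pos_of_pos hr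
  constructor
  · intro n
    have : 0 < Real.Gamma (n + r) := Real.Gamma_pos_of_pos (by positivity)
    unfold negBinomialWeight
    positivity
  · have h := (Real.one_div_one_sub_rpow_hasFPowerSeriesOnBall_zero r).hasSum
      (y := 1 - q) (by simp [enorm_eq_nnnorm, ← NNReal.coe_lt_coe, abs_of_nonneg h1, hq])
    rw [zero_add, sub_sub_cancel] at h
    have h2 := h.mul_left (q ^ r)
    rw [mul_one_div_cancel (by positivity)] at h2
    have h3 : negBinomialWeight q r = fun i => q ^ r *
        (FormalMultilinearSeries.ofScalars ℝ fun n : ℕ => Ring.choose (r + n - 1) n) i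
          fun _ => 1 - q := by
      funext n
      rw [FormalMultilinearSeries.ofScalars_apply_eq, choose_add_sub_one_eq hr, negBinomialWeight,
        smul_eq_mul]
      ring
    rw [h3]
    exact h2

theorem isStationary_secondLimit_geometricSize_iff (hlam : 0 < lam) (htheta : 0 < theta) {q : ℝ}
    (hq : 0 < q) (hq1 : q < 1) (ν : ℕ+ → ℝ) :
    IsStationary (secondLimitTransition lam (geometricSize q) theta) ν ↔
      ν = fun i => negBinomialWeight q (lam / ((1 - q) * theta)) i.natPred := by
  have h1 : 0 < 1 - q := by linarith
  have hr : 0 < lam / ((1 - q) * theta) := by positivity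
  refine isStationary_secondLimit_iff hlam htheta (isDistribution_geometricSize hq hq1)
    (summable_mul_geometricSize hq hq1)
    (isDistribution_negBinomialWeight hq hq1 hr) (fun j => ?_) ν
  set π := negBinomialWeight q (lam / ((1 - q) * theta))
  have h : ∀ n : ℕ, π (n + 1) * ((n + 1) * theta) = π n * (lam + (1 - q) * (n * theta)) := by
    intro n
    rw [← mul_assoc, negBinomialWeight_succ q hr]
    field_simp
    ring
  -- Closed form of the flow into `n` from below. Since geometric sizes are memoryless, the flow
  -- into `n + 1` from below `n` is `1 - q` times the flow into `n`; only the jump from `n` is new.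
  have hs : ∀ n : ℕ, ∑ k ∈ Finset.range n,
      π k * queueGenerator lam (geometricSize q) 0 theta k n = π n * (q * (n * theta)) := by
    intro n
    induction n with
    | zero => simp
    | succ n ih =>
      rw [Finset.sum_range_succ]
      have h2 : ∀ k ∈ Finset.range n, π k * queueGenerator lam (geometricSize q) 0 theta k (n + 1) =
          (1 - q) * (π k * queueGenerator lam (geometricSize q) 0 theta k n) := by
        intro k hk
        obtain ⟨m, rfl⟩ := Nat.exists_eq_add_of_lt (Finset.mem_range.1 hk)
        rw [show k + m + 1 = k + 1 + m by ring, add_assoc (k + 1) m 1, queueGenerator_add,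
          queueGenerator_add, geometricSize_succPNat, geometricSize_succPNat]
        ring
      have h3 := queueGenerator_add lam (geometricSize q) 0 theta n 0
      rw [geometricSize_succPNat, add_zero, pow_zero] at h3
      rw [Finset.sum_congr rfl h2, ← Finset.mul_sum, ih, h3]
      have := h n
      push_cast
      linear_combination (-q) * this
  rw [zero_add, h, hs, queueGenerator_self]
  cases j with
  | zero => simp
  | succ j =>
    rw [if_neg j.succ_ne_zero]
    ring

end Queue

/-! ### The killed and resurrected process -/

section Resurrected

variable {S : Type} {b : ℝ} {h : S → ℝ} {P : ℝ → S → S → ℝ≥0∞}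

/-- The probability of surviving until time `t`. -/
def survival (b : ℝ) (t : ℝ) : ℝ≥0∞ := ENNReal.ofReal (Real.exp (-b * t))

@[fun_prop]
theorem measurable_survival (b : ℝ) : Measurable (survival b) := by
  unfold survival; fun_prop

theorem survival_add (b u v : ℝ) : survival b (u + v) = survival b u * survival b v := by
  rw [survival, survival, survival, ← ENNReal.ofReal_mul (Real.exp_pos _).le, ← Real.exp_add,
    mul_add]

/-- The density of the time of the `(n + 1)`-st killing. -/
def erlangDensity (b : ℝ) (n : ℕ) (u : ℝ) : ℝ≥0∞ :=
  ENNReal.ofReal (b * Real.exp (-b * u) * ((b * u) ^ n / n !))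

@[fun_prop]
theorem measurable_erlangDensity (b : ℝ) (n : ℕ) : Measurable (erlangDensity b n) := by
  unfold erlangDensity; fun_prop

/-- The exponentials combine to `exp (-b * t)`, which does not depend on `u`, so only the power of
`t - u` is integrated. -/
theorem conv_erlangDensity (hb : 0 < b) (n : ℕ) {t : ℝ} (ht : 0 ≤ t) :
    conv (erlangDensity b 0) (erlangDensity b n) t = erlangDensity b (n + 1) t := by
  have h := lintegral_Icc_ofReal_of_hasDerivAt
    (F := fun u => -(b * Real.exp (-b * t) * ((b * (t - u)) ^ (n + 1) / (n + 1)!)))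
    (f := fun u => b * Real.exp (-b * u) *
      (b * Real.exp (-b * (t - u)) * ((b * (t - u)) ^ n / n !))) ht
    (fun u => by
      have h1 : HasDerivAt (fun u => b * (t - u)) (b * -1) u :=
        ((hasDerivAt_id u).const_sub t).const_mul b
      refine ((((h1.pow (n + 1)).div_const _).const_mul _).neg).congr_deriv ?_
      have h2 : Real.exp (-b * t) = Real.exp (-b * u) * Real.exp (-b * (t - u)) := by
        rw [← Real.exp_add]; ring_nf
      have h3 : (n ! : ℝ) ≠ 0 := by positivity
      rw [h2, Nat.factorial_succ]
      push_cast
      field_simp) (by fun_prop)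
    (fun u _ hu => by
      have : 0 ≤ t - u := by linarith
      positivity)
  rw [conv, erlangDensity]
  convert h using 1
  · refine setLIntegral_congr_fun measurableSet_Icc fun u hu => ?_
    simp only [erlangDensity]
    rw [← ENNReal.ofReal_mul (by have := hu.1; positivity)]
    simp
  · simp

theorem tsum_erlangDensity (hb : 0 < b) {t : ℝ} (ht : 0 ≤ t) :
    ∑' n, erlangDensity b n t = ENNReal.ofReal b := by
  have h := (NormedSpace.expSeries_div_hasSum_exp (b * t)).mul_left (b * Real.exp (-b * t))
  rw [← Real.exp_eq_exp_ℝ, mul_assoc, ← Real.exp_add, neg_mul, neg_add_cancel, Real.exp_zero,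
    mul_one] at h
  conv_rhs => rw [← h.tsum_eq]
  rw [ENNReal.ofReal_tsum_of_nonneg (fun n => by positivity) h.summable]
  simp only [erlangDensity, neg_mul]

/-- The law at time `t` of the process started from `h`. -/
def mixture (h : S → ℝ) (P : ℝ → S → S → ℝ≥0∞) (t : ℝ) (j : S) : ℝ≥0∞ :=
  ∑' m, ENNReal.ofReal (h m) * P t m j

/-- The subprobability of having survived until `t` when started from `h` and being at `j`. -/
def killedMixture (b : ℝ) (h : S → ℝ) (P : ℝ → S → S → ℝ≥0∞) (j : S) (t : ℝ) : ℝ≥0∞ :=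
  survival b t * mixture h P t j

theorem killedTransition_succ (b : ℝ) (h : S → ℝ) (P : ℝ → S → S → ℝ≥0∞) (n : ℕ) (t : ℝ)
    (i j : S) : killedTransition b h P (n + 1) t i j =
      conv (erlangDensity b 0) (fun v => mixture h (killedTransition b h P n) v j) t := by
  simp only [killedTransition, conv, erlangDensity, mixture, pow_zero, Nat.factorial_zero,
    Nat.cast_one, div_one, mul_one]

theorem mixture_killedTransition_zero (b : ℝ) (h : S → ℝ) (P : ℝ → S → S → ℝ≥0∞) (t : ℝ) (j : S) :
    mixture h (killedTransition b h P 0) t j = killedMixture b h P j t := by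
  simp only [mixture, killedTransition, killedMixture, survival, ← ENNReal.tsum_mul_left]
  exact tsum_congr fun m => mul_left_comm _ _ _

theorem conv_assoc {f g k : ℝ → ℝ≥0∞} (hf : Measurable f) (hg : Measurable g) (hk : Measurable k) :
    conv f (conv g k) = conv (conv f g) k := by
  rw [conv_comm g k, conv_left_comm hf hk hg, conv_comm k]

/-- The law of the process at a random time, exponential with parameter `b`, when started
from `h`. -/
def ageLaw (b : ℝ) (h : S → ℝ) (P : ℝ → S → S → ℝ≥0∞) (j : S) : ℝ≥0∞ :=
  ∫⁻ v in Set.Ici 0, killedMixture b h P j v * ENNReal.ofReal b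

theorem lintegral_survival (hb : 0 < b) :
    ∫⁻ v in Set.Ici 0, survival b v * ENNReal.ofReal b = 1 := by
  have h1 := integral_exp_mul_Ioi (neg_neg_of_pos hb) 0
  have h2 := integrableOn_exp_mul_Ioi (neg_neg_of_pos hb) 0
  rw [lintegral_mul_const _ (by fun_prop), setLIntegral_congr Ioi_ae_eq_Ici.symm]
  simp only [survival]
  rw [← ofReal_integral_eq_lintegral_ofReal h2 (ae_of_all _ fun u => (Real.exp_pos _).le), h1,
    ← ENNReal.ofReal_mul (by simp; positivity)]
  simp [hb.ne']

theorem tsum_mixture (hh : IsDistribution h) {t : ℝ} (hP1 : ∀ i, ∑' j, P t i j = 1) :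
    ∑' j, mixture h P t j = 1 := by
  unfold mixture
  rw [ENNReal.tsum_comm]
  simp only [ENNReal.tsum_mul_left, hP1, mul_one, hh.tsum_ofReal]

variable [Countable S]

theorem measurable_killedMixture (hP : ∀ i j, Measurable fun t => P t i j) (j : S) :
    Measurable (killedMixture b h P j) := by
  unfold killedMixture mixture
  have : ∀ m, Measurable fun t => ENNReal.ofReal (h m) * P t m j := fun m => (hP m j).const_mul _
  exact (measurable_survival b).mul (Measurable.tsum this)

/-- Each restart is from `h`, whatever happened before. Only the time of the last killing matters,
and its density is the Erlang one. -/
theorem killedTransition_succ_eq (hb : 0 < b) (hh : IsDistribution h)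
    (hP : ∀ i j, Measurable fun t => P t i j) (n : ℕ) {t : ℝ} (ht : 0 ≤ t) (i j : S) :
    killedTransition b h P (n + 1) t i j = conv (erlangDensity b n) (killedMixture b h P j) t := by
  have hm := measurable_killedMixture (b := b) (h := h) hP j
  induction n generalizing t i with
  | zero =>
    rw [killedTransition_succ]
    simp only [mixture_killedTransition_zero]
  | succ n ih =>
    rw [killedTransition_succ, conv_congr_right (h := conv (erlangDensity b n)
      (killedMixture b h P j)), conv_assoc (by fun_prop) (by fun_prop) hm, conv_comm,
      conv_comm (erlangDensity b (n + 1))]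
    · exact conv_congr_right _ fun v hv _ => conv_erlangDensity hb n hv
    · intro v hv _
      simp only [mixture, ih hv]
      rw [ENNReal.tsum_mul_right, hh.tsum_ofReal, one_mul]

/-- Summing over the number of killings replaces the Erlang densities by the constant rate `b`. The
variable `v` is the time elapsed since the last killing. -/
theorem resurrectedTransition_eq (hb : 0 < b) (hh : IsDistribution h)
    (hP : ∀ i j, Measurable fun t => P t i j) {t : ℝ} (ht : 0 ≤ t) (i j : S) :
    resurrectedTransition b h P t i j = survival b t * P t i j +
      ∫⁻ v in Set.Icc 0 t, killedMixture b h P j v * ENNReal.ofReal b := by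
  have hm := measurable_killedMixture (b := b) (h := h) hP j
  rw [resurrectedTransition, tsum_eq_zero_add' ENNReal.summable]
  congr 1
  simp only [killedTransition_succ_eq hb hh hP _ ht, conv_comm _ (killedMixture b h P j)]
  rw [← conv_tsum_right hm (by fun_prop)]
  exact conv_congr_right _ fun v hv _ => tsum_erlangDensity hb hv

theorem tsum_ageLaw (hb : 0 < b) (hh : IsDistribution h) (hP : ∀ i j, Measurable fun t => P t i j)
    (hP1 : ∀ t, 0 ≤ t → ∀ i, ∑' j, P t i j = 1) : ∑' j, ageLaw b h P j = 1 := by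
  unfold ageLaw
  rw [← lintegral_tsum fun j => ((measurable_killedMixture hP j).mul_const _).aemeasurable,
    ← lintegral_survival hb]
  refine setLIntegral_congr_fun measurableSet_Ici fun v hv => ?_
  simp only [killedMixture]
  rw [ENNReal.tsum_mul_right, ENNReal.tsum_mul_left, tsum_mixture hh (hP1 v hv), mul_one]

theorem isDistribution_ageLaw (hb : 0 < b) (hh : IsDistribution h)
    (hP : ∀ i j, Measurable fun t => P t i j)
    (hP1 : ∀ t, 0 ≤ t → ∀ i, ∑' j, P t i j = 1) :
    IsDistribution fun j => (ageLaw b h P j).toReal := by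
  have h1 := tsum_ageLaw hb hh hP hP1
  refine ⟨fun j => ENNReal.toReal_nonneg, ?_⟩
  have h2 := ENNReal.hasSum_toReal (h1 ▸ ENNReal.one_ne_top)
  rwa [← ENNReal.tsum_toReal_eq fun j => ENNReal.ne_top_of_tsum_ne_top (h1 ▸ ENNReal.one_ne_top) j,
    h1, ENNReal.toReal_one] at h2

theorem ageLaw_ne_top (hb : 0 < b) (hh : IsDistribution h)
    (hP : ∀ i j, Measurable fun t => P t i j)
    (hP1 : ∀ t, 0 ≤ t → ∀ i, ∑' j, P t i j = 1) (j : S) : ageLaw b h P j ≠ ⊤ :=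
  ENNReal.ne_top_of_tsum_ne_top (tsum_ageLaw hb hh hP hP1 ▸ ENNReal.one_ne_top) j

theorem tsum_mul_resurrectedTransition (hb : 0 < b) (hh : IsDistribution h)
    (hP : ∀ i j, Measurable fun t => P t i j) {ν : S → ℝ} (hν : IsDistribution ν) {t : ℝ}
    (ht : 0 ≤ t) (j : S) :
    ∑' i, ENNReal.ofReal (ν i) * resurrectedTransition b h P t i j =
      survival b t * mixture ν P t j +
        ∫⁻ v in Set.Icc 0 t, killedMixture b h P j v * ENNReal.ofReal b := by
  simp only [resurrectedTransition_eq hb hh hP ht, mul_add]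
  rw [ENNReal.tsum_add, ENNReal.tsum_mul_right, hν.tsum_ofReal, one_mul, mixture,
    ← ENNReal.tsum_mul_left]
  congr 1
  exact tsum_congr fun i => mul_left_comm _ _ _

theorem tendsto_survival (hb : 0 < b) : Tendsto (survival b) atTop (𝓝 0) := by
  have : Tendsto (fun t => -b * t) atTop atBot := by
    simpa using tendsto_id.const_mul_atTop_of_neg (neg_neg_of_pos hb)
  have := ENNReal.tendsto_ofReal (Real.tendsto_exp_atBot.comp this)
  rwa [ENNReal.ofReal_zero] at this

theorem tendsto_setLIntegral_Icc (f : ℝ → ℝ≥0∞) :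
    Tendsto (fun n : ℕ => ∫⁻ v in Set.Icc 0 (n : ℝ), f v) atTop (𝓝 (∫⁻ v in Set.Ici 0, f v)) := by
  have hmono : Monotone fun n : ℕ => Set.Icc (0 : ℝ) n := fun m n hmn =>
    Set.Icc_subset_Icc_right (Nat.cast_le.2 hmn)
  have hU : ⋃ n : ℕ, Set.Icc (0 : ℝ) n = Set.Ici 0 := by
    ext x
    simp only [Set.mem_iUnion, Set.mem_Icc, Set.mem_Ici, exists_and_left, and_iff_left_iff_imp]
    exact fun _ => exists_nat_ge x
  rw [← hU, setLIntegral_iUnion_of_directed f hmono.directed_le]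
  exact tendsto_atTop_iSup fun m n hmn => lintegral_mono_set (hmono hmn)

/-- As `t` tends to infinity, the memory of the initial law is lost with the survival factor, and
the integral over `[0, t]` exhausts the half-line. -/
theorem IsStationary.eq_ageLaw (hb : 0 < b) (hh : IsDistribution h)
    (hP : ∀ i j, Measurable fun t => P t i j)
    (hP1 : ∀ t, 0 ≤ t → ∀ i, ∑' j, P t i j = 1) {ν : S → ℝ}
    (hν : IsStationary (resurrectedTransition b h P) ν) (j : S) :
    ENNReal.ofReal (ν j) = ageLaw b h P j := by
  have h1 : ∀ n : ℕ, survival b n * mixture ν P n j +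
      ∫⁻ v in Set.Icc 0 (n : ℝ), killedMixture b h P j v * ENNReal.ofReal b =
        ENNReal.ofReal (ν j) := fun n => by
    rw [← tsum_mul_resurrectedTransition hb hh hP hν.1 (Nat.cast_nonneg n), hν.2 _ (Nat.cast_nonneg n)]
  have h2 : Tendsto (fun n : ℕ => survival b n * mixture ν P n j) atTop (𝓝 0) := by
    refine tendsto_of_tendsto_of_tendsto_of_le_of_le tendsto_const_nhds
      ((tendsto_survival hb).comp tendsto_natCast_atTop_atTop) (fun _ => zero_le) fun n => ?_
    refine mul_le_of_le_one_right' ?_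
    rw [← tsum_mixture hν.1 (hP1 n (Nat.cast_nonneg n))]
    exact ENNReal.le_tsum j
  have h3 := h2.add (tendsto_setLIntegral_Icc fun v => killedMixture b h P j v * ENNReal.ofReal b)
  simp only [h1, zero_add] at h3
  exact tendsto_nhds_unique tendsto_const_nhds h3

/-- By Chapman–Kolmogorov, surviving a further time `t` shifts the age from `v` to `t + v` and
yields the integral over `(t, ∞)`; the killings during `[0, t]` supply the missing part over `[0,
t]`. -/
theorem isStationary_ageLaw (hb : 0 < b) (hh : IsDistribution h)
    (hP : ∀ i j, Measurable fun t => P t i j)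
    (hP1 : ∀ t, 0 ≤ t → ∀ i, ∑' j, P t i j = 1)
    (hadd : ∀ v t, 0 ≤ v → 0 ≤ t → ∀ i j, P (v + t) i j = ∑' k, P v i k * P t k j) :
    IsStationary (resurrectedTransition b h P) fun j => (ageLaw b h P j).toReal := by
  have hd := isDistribution_ageLaw hb hh hP hP1
  refine ⟨hd, fun t ht j => ?_⟩
  have hm := fun i => (measurable_killedMixture (b := b) (h := h) hP i).mul_const (ENNReal.ofReal b)
  have h1 : survival b t * mixture (fun j => (ageLaw b h P j).toReal) P t j =
      ∫⁻ v in Set.Ici 0, killedMixture b h P j (t + v) * ENNReal.ofReal b := by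
    simp only [mixture, ENNReal.ofReal_toReal (ageLaw_ne_top hb hh hP hP1 _)]
    simp only [ageLaw, ← lintegral_mul_const _ (hm _)]
    rw [← lintegral_tsum fun i => ((hm i).mul_const _).aemeasurable,
      ← lintegral_const_mul _ (Measurable.tsum fun i => (hm i).mul_const _)]
    refine setLIntegral_congr_fun measurableSet_Ici fun v hv => ?_
    simp only [killedMixture, mixture, add_comm t v, hadd v t hv ht, survival_add]
    simp only [← ENNReal.tsum_mul_left, ← ENNReal.tsum_mul_right]
    rw [ENNReal.tsum_comm]
    exact tsum_congr fun i => tsum_congr fun k => by ring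
  have h2 : ∫⁻ v in Set.Ici 0, killedMixture b h P j (t + v) * ENNReal.ofReal b =
      ∫⁻ v in Set.Ioi t, killedMixture b h P j v * ENNReal.ofReal b := by
    rw [setLIntegral_congr Ioi_ae_eq_Ici, ← lintegral_indicator measurableSet_Ici,
      ← lintegral_indicator measurableSet_Ici,
      ← lintegral_add_left_eq_self ((Set.Ici t).indicator _) t]
    refine lintegral_congr fun u => ?_
    by_cases h0 : 0 ≤ u <;> simp [Set.indicator, h0]
  have h3 : Disjoint (Set.Icc 0 t) (Set.Ioi t) :=
    Set.disjoint_left.2 fun u hu hu' => absurd hu' (not_lt.2 hu.2)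
  have h4 := lintegral_union (μ := volume)
    (f := fun v => killedMixture b h P j v * ENNReal.ofReal b) measurableSet_Ioi h3
  rw [Set.Icc_union_Ioi_eq_Ici ht] at h4
  rw [tsum_mul_resurrectedTransition hb hh hP hd ht, h1, h2, add_comm, ← h4,
    ENNReal.ofReal_toReal (ageLaw_ne_top hb hh hP hP1 _), ageLaw]

theorem isStationary_resurrectedTransition_iff (hb : 0 < b) (hh : IsDistribution h)
    (hP : ∀ i j, Measurable fun t => P t i j)
    (hP1 : ∀ t, 0 ≤ t → ∀ i, ∑' j, P t i j = 1)
    (hadd : ∀ v t, 0 ≤ v → 0 ≤ t → ∀ i j, P (v + t) i j = ∑' k, P v i k * P t k j) (ν : S → ℝ) :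
    IsStationary (resurrectedTransition b h P) ν ↔ ν = fun j => (ageLaw b h P j).toReal := by
  refine ⟨fun hν => funext fun j => ?_, ?_⟩
  · rw [← hν.eq_ageLaw hb hh hP hP1 j, ENNReal.toReal_ofReal (hν.1.1 j)]
  · rintro rfl
    exact isStationary_ageLaw hb hh hP hP1 hadd

theorem hasSum_ageLaw (hb : 0 < b) (hh : IsDistribution h)
    (hP : ∀ i j, Measurable fun t => P t i j)
    (hP1 : ∀ t, 0 ≤ t → ∀ i, ∑' j, P t i j = 1) (j : S) :
    HasSum (fun m => b * (h m * (∫⁻ v in Set.Ioi 0, survival b v * P v m j).toReal))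
      (ageLaw b h P j).toReal := by
  have h1 : ageLaw b h P j = ∑' m, ENNReal.ofReal b *
      (ENNReal.ofReal (h m) * ∫⁻ v in Set.Ioi 0, survival b v * P v m j) := by
    have hm : ∀ m, Measurable fun v => survival b v * P v m j := fun m =>
      (measurable_survival b).mul (hP m j)
    simp only [ageLaw, killedMixture, mixture, ← setLIntegral_congr Ioi_ae_eq_Ici,
      ← lintegral_const_mul _ (hm _)]
    simp only [← lintegral_const_mul _ ((hm _).const_mul _)]
    rw [← lintegral_tsum fun m => (((hm m).const_mul _).const_mul _).aemeasurable]
    refine lintegral_congr fun v => ?_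
    simp only [← ENNReal.tsum_mul_left, ← ENNReal.tsum_mul_right]
    exact tsum_congr fun m => by ring
  have h2 := ageLaw_ne_top hb hh hP hP1 j
  rw [h1] at h2 ⊢
  rw [ENNReal.tsum_toReal_eq fun m => ENNReal.ne_top_of_tsum_ne_top h2 m]
  have h3 : (fun m => b * (h m * (∫⁻ v in Set.Ioi 0, survival b v * P v m j).toReal)) =
      fun m => (ENNReal.ofReal b * (ENNReal.ofReal (h m) *
        ∫⁻ v in Set.Ioi 0, survival b v * P v m j)).toReal := by
    funext m
    rw [ENNReal.toReal_mul, ENNReal.toReal_mul, ENNReal.toReal_ofReal hb.le,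
      ENNReal.toReal_ofReal (hh.1 m)]
  rw [h3]
  exact ENNReal.hasSum_toReal h2

end Resurrected

/-! ### The resolvent equation of a birth-and-death chain -/

section Resolvent

/-- The death rates of the queue with unit-sized orders. -/
def deathRate (mu theta : ℝ) (m : ℕ) : ℝ := if m = 0 then 0 else mu + m * theta

variable {lam mu theta : ℝ}

theorem deathRate_succ (mu theta : ℝ) (m : ℕ) :
    deathRate mu theta (m + 1) = mu + (m + 1) * theta := by
  simp [deathRate]

theorem deathRate_nonneg (hmu : 0 < mu) (htheta : 0 < theta) (m : ℕ) :
    0 ≤ deathRate mu theta m := by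
  unfold deathRate; split_ifs <;> positivity

theorem B_add_two (lam mu theta : ℝ) (s : ℂ) (m : ℕ) : B lam mu theta s (m + 2) =
    (s + lam + deathRate mu theta (m + 1)) * B lam mu theta s (m + 1) -
      lam * deathRate mu theta (m + 1) * B lam mu theta s m := by
  rw [deathRate_succ, B]
  push_cast
  ring

/-! ### Growth of the denominators -/

/-- In the recurrence, `‖s + lam + r‖ ≥ Re s + lam + r`, and the inductive bound `lam * ‖B m‖ ≤ ‖B
(m + 1)‖` lets the subtracted term absorb exactly the unbounded part `r`. -/
theorem norm_B_succ_ge (hlam : 0 < lam) (hmu : 0 < mu) (htheta : 0 < theta) {s : ℂ} (hs : 0 < s.re)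
    (m : ℕ) : (lam + s.re) * ‖B lam mu theta s m‖ ≤ ‖B lam mu theta s (m + 1)‖ := by
  have hre : ∀ x : ℝ, s.re + x ≤ ‖s + x‖ := fun x => by
    have := Complex.re_le_norm (s + x)
    simpa using this
  induction m with
  | zero =>
    have := hre lam
    simp only [B, norm_one, mul_one]
    linarith
  | succ m ih =>
    have hr := deathRate_nonneg hmu htheta (m + 1)
    set r := deathRate mu theta (m + 1) with hr_def
    rw [B_add_two, ← hr_def]
    have h1 := norm_sub_norm_le ((s + lam + r) * B lam mu theta s (m + 1))
      (lam * r * B lam mu theta s m)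
    rw [norm_mul, norm_mul, norm_mul, Complex.norm_of_nonneg hlam.le, Complex.norm_of_nonneg hr]
      at h1
    have h2 := hre (lam + r)
    push_cast at h2
    rw [← add_assoc s] at h2
    have h3 := mul_le_mul_of_nonneg_right h2 (norm_nonneg (B lam mu theta s (m + 1)))
    have h4 : r * (lam * ‖B lam mu theta s m‖) ≤ r * ‖B lam mu theta s (m + 1)‖ := by
      refine mul_le_mul_of_nonneg_left ?_ hr
      have := mul_nonneg hs.le (norm_nonneg (B lam mu theta s m))
      linarith
    linarith

theorem pow_le_norm_B (hlam : 0 < lam) (hmu : 0 < mu) (htheta : 0 < theta) {s : ℂ} (hs : 0 < s.re)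
    (m : ℕ) : (lam + s.re) ^ m ≤ ‖B lam mu theta s m‖ := by
  induction m with
  | zero => simp [B]
  | succ m ih =>
    refine le_trans ?_ (norm_B_succ_ge hlam hmu htheta hs m)
    rw [pow_succ']
    gcongr

theorem B_ne_zero (hlam : 0 < lam) (hmu : 0 < mu) (htheta : 0 < theta) {s : ℂ} (hs : 0 < s.re)
    (m : ℕ) : B lam mu theta s m ≠ 0 :=
  norm_pos_iff.1 ((pow_pos (by linarith) m).trans_le (pow_le_norm_B hlam hmu htheta hs m))

theorem tendsto_pow_div_B (hlam : 0 < lam) (hmu : 0 < mu) (htheta : 0 < theta) {s : ℂ}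
    (hs : 0 < s.re) : Tendsto (fun m => (lam : ℂ) ^ m / B lam mu theta s m) atTop (𝓝 0) := by
  refine squeeze_zero_norm (a := fun m => (lam / (lam + s.re)) ^ m) (fun m => ?_)
    (tendsto_pow_atTop_nhds_zero_of_lt_one (by positivity)
      ((div_lt_one (by positivity)).2 (by linarith)))
  rw [norm_div, norm_pow, Complex.norm_of_nonneg hlam.le, div_pow]
  have := pow_le_norm_B hlam hmu htheta hs m
  gcongr

/-! ### Convergents of the continued fraction -/

/-- The numerators of the convergents, up to the factor `B`. -/
def numer (lam mu theta : ℝ) (s : ℂ) (n : ℕ) : ℕ → ℂ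
  | 0 => 0
  | 1 => 1
  | N + 2 => (s + lam + deathRate mu theta (n + N + 1)) * numer lam mu theta s n (N + 1) -
      lam * deathRate mu theta (n + N + 1) * numer lam mu theta s n N

theorem fraction_get? (lam mu theta : ℝ) (k l : ℕ) (s : ℂ) (i : ℕ) :
    (fraction lam mu theta k l s).s.get? i =
      some ⟨partNum lam mu theta k l s (i + 1), partDen lam mu theta l s (i + 1)⟩ := rfl

theorem nums_fraction (lam mu theta : ℝ) (k l : ℕ) (s : ℂ) (N : ℕ) :
    (fraction lam mu theta k l s).nums N = B lam mu theta s k * numer lam mu theta s l N := by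
  have h1 := GenContFract.first_num_eq (fraction_get? lam mu theta k l s 0)
  have h0 : (fraction lam mu theta k l s).nums 0 = 0 := by
    rw [GenContFract.zeroth_num_eq_h]; rfl
  induction N using Nat.twoStepInduction with
  | zero => rw [h0, numer, mul_zero]
  | one =>
    rw [h1]
    simp [fraction, partNum, numer]
  | more N ih0 ih1 =>
    rw [GenContFract.nums_recurrence (fraction_get? lam mu theta k l s (N + 1)) ih0 ih1, numer,
      deathRate_succ]
    cases N with
    -- Here the second partial numerator, with its exceptional factor `B l`, is multiplied by the
    -- zeroth numerator, which vanishes.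
    | zero =>
      simp [partDen, numer]
      ring
    | succ N =>
      simp [partNum, partDen]
      ring

/-- The factor `B l` in the second partial numerator compensates for the zeroth denominator being
`1` instead of `B l`. From index `1` on the denominators follow the recurrence of `B`. -/
theorem dens_fraction (lam mu theta : ℝ) (k l : ℕ) (s : ℂ) (N : ℕ) :
    (fraction lam mu theta k l s).dens (N + 1) = B lam mu theta s (l + N + 1) := by
  have h1 := GenContFract.first_den_eq (fraction_get? lam mu theta k l s 0)
  have h0 := (fraction lam mu theta k l s).zeroth_den_eq_one
  induction N using Nat.twoStepInduction with
  | zero =>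
    rw [h1]
    simp [partDen]
  | one =>
    rw [GenContFract.dens_recurrence (fraction_get? lam mu theta k l s 1) h0 h1, B_add_two,
      deathRate_succ]
    simp [partNum, partDen]
    ring
  | more N ih0 ih1 =>
    rw [GenContFract.dens_recurrence (fraction_get? lam mu theta k l s (N + 2)) ih0 ih1,
      show l + (N + 2) + 1 = (l + N + 1) + 2 by ring, B_add_two, deathRate_succ]
    simp [partNum, partDen]
    ring_nf

/-! ### Bounded solutions of the resolvent equations -/

/-- The equations satisfied by the `n`-th column of the resolvent. -/
def IsResolvent (lam mu theta : ℝ) (s : ℂ) (n : ℕ) (f : ℕ → ℂ) : Prop :=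
  ∀ m, (s + lam + deathRate mu theta m) * f m =
    (if m = n then 1 else 0) + lam * f (m + 1) + deathRate mu theta m * f (m - 1)

/-- The equations at states below `n` have no source and are, after scaling by powers of `lam`, the
recurrence of `B`. -/
theorem IsResolvent.pow_mul_eq {s : ℂ} {n : ℕ} {f : ℕ → ℂ} (hf : IsResolvent lam mu theta s n f)
    {m : ℕ} (hm : m ≤ n) : (lam : ℂ) ^ m * f m = f 0 * B lam mu theta s m := by
  induction m using Nat.twoStepInduction with
  | zero => simp [B]
  | one =>
    have h := hf 0
    rw [if_neg (by omega)] at h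
    simp [deathRate] at h
    simp [B, ← h, mul_comm]
  | more m ih0 ih1 =>
    have h := hf (m + 1)
    rw [if_neg (by omega), Nat.add_sub_cancel] at h
    rw [B_add_two]
    have h0 := ih0 (by omega)
    have h1 := ih1 (by omega)
    linear_combination (-(lam : ℂ) ^ (m + 1)) * h +
      (s + lam + deathRate mu theta (m + 1)) * h1 - lam * deathRate mu theta (m + 1) * h0

/-- The source at `n` switches on a second solution of the same recurrence, with initial values `0`
at `n` and `1` at `n + 1`, which is `numer`. -/
theorem IsResolvent.pow_mul_add_eq {s : ℂ} {n : ℕ} {f : ℕ → ℂ}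
    (hf : IsResolvent lam mu theta s n f) (N : ℕ) :
    (lam : ℂ) ^ (n + N) * f (n + N) =
      f 0 * B lam mu theta s (n + N) - (lam : ℂ) ^ n * numer lam mu theta s n N := by
  induction N using Nat.twoStepInduction with
  | zero => simp [hf.pow_mul_eq le_rfl, numer]
  | one =>
    have h := hf n
    rw [if_pos rfl] at h
    have h1 := hf.pow_mul_eq le_rfl
    rw [numer]
    cases n with
    | zero =>
      simp [deathRate] at h
      simp [B]
      linear_combination -h
    | succ n =>
      have h0 := hf.pow_mul_eq n.le_succ
      rw [Nat.add_sub_cancel] at h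
      rw [B_add_two]
      linear_combination (-(lam : ℂ) ^ (n + 1)) * h +
        (s + lam + deathRate mu theta (n + 1)) * h1 - lam * deathRate mu theta (n + 1) * h0
  | more N ih0 ih1 =>
    have h := hf (n + N + 1)
    rw [if_neg (by omega), Nat.add_sub_cancel] at h
    rw [← add_assoc, B_add_two, numer]
    rw [← add_assoc] at ih1
    linear_combination (-(lam : ℂ) ^ (n + N + 1)) * h +
      (s + lam + deathRate mu theta (n + N + 1)) * ih1 -
        lam * deathRate mu theta (n + N + 1) * ih0

/-- After division by `B (n + N)` the left side of `IsResolvent.pow_mul_add_eq` tends to zero,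
because `f` is bounded and `lam ^ m / B m` vanishes at infinity. This determines `f 0`. -/
theorem IsResolvent.tendsto_zero (hlam : 0 < lam) (hmu : 0 < mu) (htheta : 0 < theta)
    {s : ℂ} (hs : 0 < s.re) {n : ℕ} {f : ℕ → ℂ} (hf : IsResolvent lam mu theta s n f) {C : ℝ}
    (hC : ∀ m, ‖f m‖ ≤ C) :
    Tendsto (fun N => (lam : ℂ) ^ n * (numer lam mu theta s n N / B lam mu theta s (n + N))) atTop
      (𝓝 (f 0)) := by
  have h1 : Tendsto (fun m => (lam : ℂ) ^ m / B lam mu theta s m * f m) atTop (𝓝 0) :=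
    (tendsto_pow_div_B hlam hmu htheta hs).zero_mul_isBoundedUnder_le
      (isBoundedUnder_of ⟨C, hC⟩)
  have h2 := (h1.comp (tendsto_add_atTop_nat n)).const_sub (f 0)
  rw [sub_zero] at h2
  refine h2.congr fun N => ?_
  have hB := B_ne_zero hlam hmu htheta hs (n + N)
  simp only [Function.comp, add_comm N n]
  rw [div_mul_eq_mul_div, hf.pow_mul_add_eq]
  field_simp
  ring

/-- The value at `m ≤ n` is `f 0` times `B m / lam ^ m`, and the factor `B m` is the first partial
numerator. -/
theorem IsResolvent.tendsto_convs (hlam : 0 < lam) (hmu : 0 < mu) (htheta : 0 < theta)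
    {s : ℂ} (hs : 0 < s.re) {n : ℕ} {f : ℕ → ℂ} (hf : IsResolvent lam mu theta s n f) {C : ℝ}
    (hC : ∀ m, ‖f m‖ ≤ C) {m : ℕ} (hm : m ≤ n) :
    Tendsto (fun N => (lam : ℂ) ^ (n - m) * (fraction lam mu theta m n s).convs N) atTop
      (𝓝 (f m)) := by
  have hl : (lam : ℂ) ≠ 0 := Complex.ofReal_ne_zero.2 hlam.ne'
  have h1 := (hf.tendsto_zero hlam hmu htheta hs hC).mul_const
    (B lam mu theta s m / (lam : ℂ) ^ m)
  rw [mul_div_assoc', ← hf.pow_mul_eq hm, mul_div_cancel_left₀ _ (pow_ne_zero _ hl)] at h1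
  rw [← tendsto_add_atTop_iff_nat 1] at h1 ⊢
  refine h1.congr fun N => ?_
  have hB := B_ne_zero hlam hmu htheta hs (n + N + 1)
  rw [GenContFract.convs, nums_fraction, dens_fraction, ← Nat.sub_add_cancel hm, pow_add,
    Nat.sub_add_cancel hm, ← add_assoc]
  field_simp

/-! ### Reversibility of the resolvent -/

/-- The weights with respect to which the chain is reversible. -/
def reversibleWeight (lam mu theta : ℝ) (m : ℕ) : ℝ :=
  ∏ j ∈ Finset.range m, lam / deathRate mu theta (j + 1)

theorem reversibleWeight_succ (hmu : 0 < mu) (htheta : 0 < theta) (m : ℕ) :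
    reversibleWeight lam mu theta (m + 1) * deathRate mu theta (m + 1) =
      lam * reversibleWeight lam mu theta m := by
  have : deathRate mu theta (m + 1) ≠ 0 := by rw [deathRate_succ]; positivity
  rw [reversibleWeight, Finset.prod_range_succ, ← reversibleWeight]
  field_simp

theorem reversibleWeight_pos (hlam : 0 < lam) (hmu : 0 < mu) (htheta : 0 < theta) (m : ℕ) :
    0 < reversibleWeight lam mu theta m :=
  Finset.prod_pos fun j _ => by rw [deathRate_succ]; positivity

theorem tendsto_reversibleWeight (hlam : 0 < lam) (hmu : 0 < mu) (htheta : 0 < theta) :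
    Tendsto (reversibleWeight lam mu theta) atTop (𝓝 0) := by
  refine squeeze_zero (fun m => (reversibleWeight_pos hlam hmu htheta m).le) (fun m => ?_)
    (FloorSemiring.tendsto_pow_div_factorial_atTop (lam / theta))
  induction m with
  | zero => simp [reversibleWeight]
  | succ m ih =>
    rw [reversibleWeight, Finset.prod_range_succ, ← reversibleWeight, Nat.factorial_succ, pow_succ]
    have h1 : lam / deathRate mu theta (m + 1) ≤ lam / theta / (m + 1) := by
      rw [deathRate_succ, div_div]
      gcongr
      linarith
    have h2 := mul_le_mul ih h1 (by rw [deathRate_succ]; positivity) (by positivity)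
    refine h2.trans_eq ?_
    push_cast
    field_simp

/-- Green's identity for the symmetric form of the recurrence: the weighted Wronskian of the two
columns changes only at the sources `m` and `n`, and it vanishes at infinity since the weights tend
to zero and the columns are bounded. -/
theorem IsResolvent.reversible (hlam : 0 < lam) (hmu : 0 < mu) (htheta : 0 < theta)
    {s : ℂ} {m n : ℕ} {f g : ℕ → ℂ} (hf : IsResolvent lam mu theta s m f)
    (hg : IsResolvent lam mu theta s n g) {C : ℝ} (hCf : ∀ i, ‖f i‖ ≤ C) (hCg : ∀ i, ‖g i‖ ≤ C) :
    reversibleWeight lam mu theta m * g m = reversibleWeight lam mu theta n * f n := by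
  set w := reversibleWeight lam mu theta
  have hw : ∀ i, (w (i + 1) : ℂ) * deathRate mu theta (i + 1) = lam * w i := fun i => by
    exact_mod_cast reversibleWeight_succ hmu htheta i
  have h1 : ∀ N, lam * w N * (f N * g (N + 1) - f (N + 1) * g N) =
      (if m ≤ N then w m * g m else 0) - if n ≤ N then w n * f n else 0 := by
    intro N
    induction N with
    | zero =>
      have hf0 := hf 0
      have hg0 := hg 0
      simp only [deathRate, if_true, Complex.ofReal_zero, zero_mul, add_zero] at hf0 hg0
      have e1 : (if m ≤ 0 then w m * g m else 0 : ℂ) = (if 0 = m then 1 else 0) * (w 0 * g 0) := by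
        rcases Nat.eq_zero_or_pos m with rfl | h
        · simp
        · simp [h.ne, h.ne']
      have e2 : (if n ≤ 0 then w n * f n else 0 : ℂ) = (if 0 = n then 1 else 0) * (w 0 * f 0) := by
        rcases Nat.eq_zero_or_pos n with rfl | h
        · simp
        · simp [h.ne, h.ne']
      rw [e1, e2]
      linear_combination w 0 * g 0 * hf0 - w 0 * f 0 * hg0
    | succ N ih =>
      have hf1 := hf (N + 1)
      have hg1 := hg (N + 1)
      rw [Nat.add_sub_cancel] at hf1 hg1
      have e : ∀ (k : ℕ) (u : ℕ → ℂ), (if k ≤ N + 1 then w k * u k else 0 : ℂ) =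
          (if k ≤ N then w k * u k else 0) + (if N + 1 = k then 1 else 0) *
            (w (N + 1) * u (N + 1)) := by
        intro k u
        rcases lt_trichotomy k (N + 1) with h | rfl | h
        · simp [h.le, Nat.lt_succ_iff.1 h, h.ne']
        · simp
        · simp [h.ne, not_le.2 h, not_le.2 (Nat.lt_of_succ_lt h)]
      rw [e m g, e n f]
      have hwN := hw N
      linear_combination ih + w (N + 1) * g (N + 1) * hf1 - w (N + 1) * f (N + 1) * hg1 +
        (f N * g (N + 1) - f (N + 1) * g N) * hwN
  have h2 : Tendsto (fun N => (w N : ℂ) * (lam * (f N * g (N + 1) - f (N + 1) * g N))) atTop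
      (𝓝 0) := by
    have h3 : Tendsto (fun N => (w N : ℂ)) atTop (𝓝 0) := by
      exact_mod_cast (Complex.continuous_ofReal.tendsto 0).comp
        (tendsto_reversibleWeight hlam hmu htheta)
    refine h3.zero_mul_isBoundedUnder_le (isBoundedUnder_of ⟨lam * (C * C + C * C), fun N => ?_⟩)
    have hC0 : 0 ≤ C := (norm_nonneg _).trans (hCf 0)
    simp only [Function.comp, norm_mul, Complex.norm_of_nonneg hlam.le]
    gcongr
    refine (norm_sub_le _ _).trans ?_
    rw [norm_mul, norm_mul]
    gcongr <;> first | exact hCf _ | exact hCg _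
  have h4 : ∀ᶠ N in atTop, (w N : ℂ) * (lam * (f N * g (N + 1) - f (N + 1) * g N)) =
      w m * g m - w n * f n := by
    filter_upwards [eventually_ge_atTop m, eventually_ge_atTop n] with N hm hn
    rw [← mul_assoc, mul_comm (w N : ℂ), h1, if_pos hm, if_pos hn]
  have h5 := tendsto_nhds_unique (h2.congr' h4) tendsto_const_nhds
  exact sub_eq_zero.1 h5.symm

theorem reversibleWeight_mul_prod (hmu : 0 < mu) (htheta : 0 < theta) {m n : ℕ} (h : n ≤ m) :
    reversibleWeight lam mu theta m * ∏ j ∈ Finset.Icc (n + 1) m, (mu + j * theta) =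
      lam ^ (m - n) * reversibleWeight lam mu theta n := by
  induction m, h using Nat.le_induction with
  | base => simp
  | succ m hnm ih =>
    have h1 := reversibleWeight_succ (lam := lam) hmu htheta m
    rw [Finset.prod_Icc_succ_top (by omega), Nat.sub_add_comm hnm, pow_succ]
    rw [deathRate_succ] at h1
    push_cast
    linear_combination lam * ih + (∏ j ∈ Finset.Icc (n + 1) m, (mu + j * theta)) * h1

/-- Reversibility exchanges the two indices, reducing to column `m` evaluated at `n ≤ m`. The ratio
of weights is the product of death rates over `lam ^ (m - n)`, which cancels the power in
`IsResolvent.tendsto_convs`. -/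
theorem IsResolvent.tendsto_convs_of_ge (hlam : 0 < lam) (hmu : 0 < mu) (htheta : 0 < theta)
    {s : ℂ} (hs : 0 < s.re) {m n : ℕ} {f g : ℕ → ℂ} (hf : IsResolvent lam mu theta s m f)
    (hg : IsResolvent lam mu theta s n g) {C : ℝ} (hCf : ∀ i, ‖f i‖ ≤ C) (hCg : ∀ i, ‖g i‖ ≤ C)
    (hm : n ≤ m) :
    Tendsto (fun N => (∏ j ∈ Finset.Icc (n + 1) m, ((mu : ℂ) + j * theta)) *
      (fraction lam mu theta n m s).convs N) atTop (𝓝 (g m)) := by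
  have hl : (lam : ℂ) ≠ 0 := Complex.ofReal_ne_zero.2 hlam.ne'
  have h1 := (hf.tendsto_convs hlam hmu htheta hs hCf hm).const_mul
    ((∏ j ∈ Finset.Icc (n + 1) m, ((mu : ℂ) + j * theta)) / (lam : ℂ) ^ (m - n))
  have h2 := hf.reversible hlam hmu htheta hg hCf hCg
  have h3 : (reversibleWeight lam mu theta m : ℂ) *
      ∏ j ∈ Finset.Icc (n + 1) m, ((mu : ℂ) + j * theta) =
        (lam : ℂ) ^ (m - n) * reversibleWeight lam mu theta n := by
    exact_mod_cast reversibleWeight_mul_prod hmu htheta hm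
  have h4 : (reversibleWeight lam mu theta m : ℂ) ≠ 0 :=
    Complex.ofReal_ne_zero.2 (reversibleWeight_pos hlam hmu htheta m).ne'
  have h5 : (∏ j ∈ Finset.Icc (n + 1) m, ((mu : ℂ) + j * theta)) / (lam : ℂ) ^ (m - n) * f n =
      g m := by
    rw [div_mul_eq_mul_div, div_eq_iff (pow_ne_zero _ hl), ← mul_right_inj' h4]
    linear_combination f n * h3 - (lam : ℂ) ^ (m - n) * h2
  rw [h5] at h1
  refine h1.congr fun N => ?_
  rw [← mul_assoc, div_mul_cancel₀ _ (pow_ne_zero _ hl)]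

end Resolvent

/-! ### Laplace transforms of the transition probabilities -/

section Laplace

variable {lam mu theta : ℝ}

/-- The transition probabilities of the queue with unit sizes, extended to an even function of
time. -/
def evenTransition (lam mu theta : ℝ) (m n : ℕ) (t : ℝ) : ℝ :=
  (transition (queueGenerator lam unitSize mu theta) |t| m n).toReal

theorem isConservative_unitSize (hlam : 0 < lam) (hmu : 0 < mu) (htheta : 0 < theta) :
    IsConservative (queueGenerator lam unitSize mu theta) :=
  isConservative_queueGenerator hlam hmu.le htheta isDistribution_unitSize

theorem ofReal_evenTransition (hlam : 0 < lam) (hmu : 0 < mu) (htheta : 0 < theta) (m n : ℕ)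
    {t : ℝ} (ht : 0 ≤ t) : ENNReal.ofReal (evenTransition lam mu theta m n t) =
      transition (queueGenerator lam unitSize mu theta) t m n := by
  rw [evenTransition, abs_of_nonneg ht, ENNReal.ofReal_toReal]
  exact ne_top_of_le_ne_top ENNReal.one_ne_top
    (transition_le_one (isConservative_unitSize hlam hmu htheta) ht m n)

theorem evenTransition_nonneg (lam mu theta : ℝ) (m n : ℕ) (t : ℝ) :
    0 ≤ evenTransition lam mu theta m n t := ENNReal.toReal_nonneg

theorem evenTransition_le_one (hlam : 0 < lam) (hmu : 0 < mu) (htheta : 0 < theta) (m n : ℕ)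
    (t : ℝ) : evenTransition lam mu theta m n t ≤ 1 :=
  ENNReal.toReal_le_of_le_ofReal zero_le_one (by
    rw [ENNReal.ofReal_one]
    exact transition_le_one (isConservative_unitSize hlam hmu htheta) (abs_nonneg t) m n)

@[fun_prop]
theorem measurable_evenTransition (lam mu theta : ℝ) (m n : ℕ) :
    Measurable (evenTransition lam mu theta m n) :=
  ((measurable_transition _ m n).comp measurable_id.abs).ennreal_toReal

/-- The rate at which the state `n` is reached at time `t` by the chains started after the first
jump from `m`. -/
def inflow (lam mu theta : ℝ) (m n : ℕ) (t : ℝ) : ℝ :=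
  lam * evenTransition lam mu theta (m + 1) n t +
    deathRate mu theta m * evenTransition lam mu theta (m - 1) n t

theorem inflow_nonneg (hlam : 0 < lam) (hmu : 0 < mu) (htheta : 0 < theta) (m n : ℕ) (t : ℝ) :
    0 ≤ inflow lam mu theta m n t := by
  have h1 := evenTransition_nonneg lam mu theta (m + 1) n t
  have h2 := evenTransition_nonneg lam mu theta (m - 1) n t
  have h3 := deathRate_nonneg hmu htheta m
  unfold inflow
  positivity

theorem inflow_le (hlam : 0 < lam) (hmu : 0 < mu) (htheta : 0 < theta) (m n : ℕ) (t : ℝ) :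
    inflow lam mu theta m n t ≤ lam + deathRate mu theta m := by
  have h1 := evenTransition_le_one hlam hmu htheta (m + 1) n t
  have h2 := evenTransition_le_one hlam hmu htheta (m - 1) n t
  have h3 := deathRate_nonneg hmu htheta m
  unfold inflow
  nlinarith

@[fun_prop]
theorem measurable_inflow (lam mu theta : ℝ) (m n : ℕ) : Measurable (inflow lam mu theta m n) := by
  unfold inflow; fun_prop

theorem ofReal_inflow (hlam : 0 < lam) (hmu : 0 < mu) (htheta : 0 < theta) (m n : ℕ)
    {t : ℝ} (ht : 0 ≤ t) : ∑' k, jumpRate (queueGenerator lam unitSize mu theta) m k *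
        transition (queueGenerator lam unitSize mu theta) t k n =
      ENNReal.ofReal (inflow lam mu theta m n t) := by
  have h1 := evenTransition_nonneg lam mu theta (m + 1) n t
  have h2 := evenTransition_nonneg lam mu theta (m - 1) n t
  have h3 := deathRate_nonneg hmu htheta m
  rw [tsum_jumpRate_queueGenerator, inflow,
    ENNReal.ofReal_add (p := lam * _) (by positivity) (by positivity),
    ENNReal.ofReal_mul hlam.le, ENNReal.ofReal_mul h3, ofReal_evenTransition hlam hmu htheta _ _ ht,
    ofReal_evenTransition hlam hmu htheta _ _ ht, add_comm]
  congr 1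
  · rw [tsum_eq_single 0 fun k hk => by simp [unitSize_succPNat, hk]]
    simp [unitSize_succPNat]
  · unfold deathRate
    split_ifs <;> simp

/-- The right-hand side of the backward integral equation. -/
def backwardRHS (lam mu theta : ℝ) (m n : ℕ) (t : ℝ) : ℝ :=
  Real.exp (-(lam + deathRate mu theta m) * t) * ((if m = n then 1 else 0) +
    ∫ v in 0..t, Real.exp ((lam + deathRate mu theta m) * v) * inflow lam mu theta m n v)

theorem intervalIntegrable_inflow (hlam : 0 < lam) (hmu : 0 < mu) (htheta : 0 < theta) (m n : ℕ)
    (c a b : ℝ) :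
    IntervalIntegrable (fun v => Real.exp (c * v) * inflow lam mu theta m n v) volume a b := by
  have h1 : IntervalIntegrable (inflow lam mu theta m n) volume a b :=
    (intervalIntegrable_const (c := lam + deathRate mu theta m)).mono_fun
      (measurable_inflow lam mu theta m n).aestronglyMeasurable (ae_of_all _ fun t => by
        change ‖inflow lam mu theta m n t‖ ≤ ‖lam + deathRate mu theta m‖
        rw [Real.norm_of_nonneg (inflow_nonneg hlam hmu htheta m n t)]
        exact (inflow_le hlam hmu htheta m n t).trans (le_abs_self _))
  exact h1.continuousOn_mul (by fun_prop)

/-- The substitution `v = t - u` moves `t` out of the integrand, so that regularity in `t` can be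
read off a primitive. -/
theorem evenTransition_eq_backwardRHS (hlam : 0 < lam) (hmu : 0 < mu) (htheta : 0 < theta)
    (m n : ℕ) {t : ℝ} (ht : 0 ≤ t) :
    evenTransition lam mu theta m n t = backwardRHS lam mu theta m n t := by
  set q := lam + deathRate mu theta m with hq
  have hqA : queueGenerator lam unitSize mu theta m m = -q := by
    rw [queueGenerator_self, hq, deathRate]
  have hint : ∀ u, 0 ≤ Real.exp (-q * u) * inflow lam mu theta m n (t - u) := fun u =>
    mul_nonneg (Real.exp_pos _).le (inflow_nonneg hlam hmu htheta m n _)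
  have h1 : conv (stay (queueGenerator lam unitSize mu theta) m)
      (fun v => ∑' k, jumpRate (queueGenerator lam unitSize mu theta) m k *
        transition (queueGenerator lam unitSize mu theta) v k n) t =
      ENNReal.ofReal (∫ u in 0..t, Real.exp (-q * u) * inflow lam mu theta m n (t - u)) := by
    rw [conv_congr_right (h := fun v => ENNReal.ofReal (inflow lam mu theta m n v)) _
      fun v hv _ => ofReal_inflow hlam hmu htheta m n hv, conv]
    rw [intervalIntegral.integral_of_le ht,
      ← integral_Icc_eq_integral_Ioc, ofReal_integral_eq_lintegral_ofReal _
        (ae_of_all _ hint)]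
    · refine lintegral_congr fun u => ?_
      rw [stay, hqA, ← ENNReal.ofReal_mul (Real.exp_pos _).le]
    · refine Measure.integrableOn_of_bounded (M := q) (by simp)
        (Measurable.aestronglyMeasurable (by fun_prop)) ?_
      filter_upwards [ae_restrict_mem measurableSet_Icc] with u hu
      have hq0 : 0 ≤ q := by have := deathRate_nonneg hmu htheta m; positivity
      rw [Real.norm_of_nonneg (hint u)]
      have h1 : Real.exp (-q * u) ≤ 1 := by
        rw [Real.exp_le_one_iff]
        nlinarith [hu.1]
      have h2 := mul_le_mul h1 (inflow_le hlam hmu htheta m n (t - u))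
        (inflow_nonneg hlam hmu htheta m n _) zero_le_one
      rwa [one_mul] at h2
  have h2 : ∫ u in 0..t, Real.exp (-q * u) * inflow lam mu theta m n (t - u) =
      Real.exp (-q * t) * ∫ v in 0..t, Real.exp (q * v) * inflow lam mu theta m n v := by
    have := intervalIntegral.integral_comp_sub_left (a := 0) (b := t)
      (fun v => Real.exp (-q * (t - v)) * inflow lam mu theta m n v) t
    simp only [sub_sub_cancel, sub_self, sub_zero] at this
    rw [this, ← intervalIntegral.integral_const_mul]
    refine intervalIntegral.integral_congr fun v _ => ?_
    rw [← mul_assoc, ← Real.exp_add]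
    ring_nf
  have h3 : 0 ≤ ∫ u in 0..t, Real.exp (-q * u) * inflow lam mu theta m n (t - u) :=
    intervalIntegral.integral_nonneg ht fun u _ => hint u
  rw [evenTransition, abs_of_nonneg ht, transition_backward, h1, backwardRHS, mul_add, ← hq, ← h2,
    ENNReal.toReal_add (by split_ifs <;> simp [stay]) ENNReal.ofReal_ne_top,
    ENNReal.toReal_ofReal h3]
  congr 1
  split_ifs
  · rw [stay, hqA, ENNReal.toReal_ofReal (Real.exp_pos _).le, mul_one]
  · simp

theorem continuous_backwardRHS (hlam : 0 < lam) (hmu : 0 < mu) (htheta : 0 < theta) (m n : ℕ) :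
    Continuous (backwardRHS lam mu theta m n) := by
  have := intervalIntegral.continuous_primitive
    (fun a b => intervalIntegrable_inflow hlam hmu htheta m n (lam + deathRate mu theta m) a b) 0
  unfold backwardRHS
  fun_prop

/-- Bootstrapping: a primitive of a locally integrable function is continuous, hence so are the
transition probabilities and the inflow, and the right-hand side becomes differentiable. The even
extension gives continuity on all of `ℝ`, avoiding one-sided statements at `0`. -/
theorem continuous_evenTransition (hlam : 0 < lam) (hmu : 0 < mu) (htheta : 0 < theta) (m n : ℕ) :
    Continuous (evenTransition lam mu theta m n) := by
  have : evenTransition lam mu theta m n = fun t => backwardRHS lam mu theta m n |t| := by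
    funext t
    rw [← evenTransition_eq_backwardRHS hlam hmu htheta m n (abs_nonneg t), evenTransition,
      evenTransition, abs_abs]
  rw [this]
  exact (continuous_backwardRHS hlam hmu htheta m n).comp continuous_abs

theorem continuous_inflow (hlam : 0 < lam) (hmu : 0 < mu) (htheta : 0 < theta) (m n : ℕ) :
    Continuous (inflow lam mu theta m n) := by
  have h1 := continuous_evenTransition hlam hmu htheta (m + 1) n
  have h2 := continuous_evenTransition hlam hmu htheta (m - 1) n
  unfold inflow
  fun_prop

/-- The backward Kolmogorov equation. -/
theorem hasDerivAt_backwardRHS (hlam : 0 < lam) (hmu : 0 < mu) (htheta : 0 < theta) (m n : ℕ)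
    (t : ℝ) : HasDerivAt (backwardRHS lam mu theta m n)
      (-(lam + deathRate mu theta m) * backwardRHS lam mu theta m n t + inflow lam mu theta m n t)
      t := by
  have hc : Continuous fun v => Real.exp ((lam + deathRate mu theta m) * v) *
      inflow lam mu theta m n v :=
    (by fun_prop : Continuous fun v => Real.exp ((lam + deathRate mu theta m) * v)).mul
      (continuous_inflow hlam hmu htheta m n)
  have h1 := (hc.integral_hasStrictDerivAt 0 t).hasDerivAt.const_add (if m = n then (1 : ℝ) else 0)
  have h2 := hasDerivAt_exp_mul (-(lam + deathRate mu theta m)) t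
  refine (h2.mul h1).congr_deriv ?_
  rw [← mul_assoc (Real.exp _) (Real.exp _), ← Real.exp_add, neg_mul, neg_add_cancel,
    Real.exp_zero, one_mul, backwardRHS]
  ring_nf

theorem laplaceIntegrand_eq (lam mu theta : ℝ) (m n : ℕ) (s : ℂ) {t : ℝ} (ht : 0 < t) :
    laplaceIntegrand lam mu theta m n s t =
      Complex.exp (-s * t) * evenTransition lam mu theta m n t := by
  rw [laplaceIntegrand, evenTransition, abs_of_pos ht]

theorem norm_exp_mul (s : ℂ) (t : ℝ) : ‖Complex.exp (-s * t)‖ = Real.exp (-s.re * t) := by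
  rw [Complex.norm_exp]
  simp

theorem norm_laplaceIntegrand_le (hlam : 0 < lam) (hmu : 0 < mu) (htheta : 0 < theta) (m n : ℕ)
    (s : ℂ) {t : ℝ} (ht : 0 < t) :
    ‖laplaceIntegrand lam mu theta m n s t‖ ≤ Real.exp (-s.re * t) := by
  rw [laplaceIntegrand_eq _ _ _ _ _ _ ht, norm_mul, norm_exp_mul,
    Complex.norm_of_nonneg (evenTransition_nonneg lam mu theta m n t)]
  exact mul_le_of_le_one_right (Real.exp_pos _).le (evenTransition_le_one hlam hmu htheta m n t)

theorem integrableOn_laplaceIntegrand (hlam : 0 < lam) (hmu : 0 < mu) (htheta : 0 < theta)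
    (m n : ℕ) {s : ℂ} (hs : 0 < s.re) :
    IntegrableOn (laplaceIntegrand lam mu theta m n s) (Set.Ioi 0) := by
  refine (integrableOn_exp_mul_Ioi (neg_neg_of_pos hs) 0).mono' ?_ ?_
  · refine Measurable.aestronglyMeasurable ?_
    unfold laplaceIntegrand
    have := measurable_transition (queueGenerator lam unitSize mu theta) m n
    fun_prop
  · filter_upwards [ae_restrict_mem measurableSet_Ioi] with t ht using
      norm_laplaceIntegrand_le hlam hmu htheta m n s ht

/-- The bound does not depend on `m` or `n`; it is the boundedness that singles out the right
solution of the resolvent equations. -/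
theorem norm_qHat_le (hlam : 0 < lam) (hmu : 0 < mu) (htheta : 0 < theta) (m n : ℕ) {s : ℂ}
    (hs : 0 < s.re) : ‖qHat lam mu theta m n s‖ ≤ ∫ t in Set.Ioi 0, Real.exp (-s.re * t) := by
  refine norm_integral_le_of_norm_le (integrableOn_exp_mul_Ioi (neg_neg_of_pos hs) 0) ?_
  filter_upwards [ae_restrict_mem measurableSet_Ioi] with t ht using
    norm_laplaceIntegrand_le hlam hmu htheta m n s ht

theorem isResolvent_qHat (hlam : 0 < lam) (hmu : 0 < mu) (htheta : 0 < theta) (n : ℕ) {s : ℂ}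
    (hs : 0 < s.re) : IsResolvent lam mu theta s n fun m => qHat lam mu theta m n s := by
  intro m
  have hi := fun k => integrableOn_laplaceIntegrand hlam hmu htheta k n hs
  set q := lam + deathRate mu theta m with hq
  have hd : ∀ t : ℝ, HasDerivAt
      (fun t : ℝ => Complex.exp (-s * t) * (backwardRHS lam mu theta m n t : ℂ))
      (Complex.exp (-s * t) * -s * (backwardRHS lam mu theta m n t : ℂ) + Complex.exp (-s * t) *
        ((-q * backwardRHS lam mu theta m n t + inflow lam mu theta m n t : ℝ) : ℂ)) t := by
    intro t
    have h1 : HasDerivAt (fun t : ℝ => Complex.exp (-s * t)) (Complex.exp (-s * t) * -s) t := by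
      simpa using ((Complex.ofRealCLM.hasDerivAt (x := t)).const_mul (-s)).cexp
    exact h1.mul (hasDerivAt_backwardRHS hlam hmu htheta m n t).ofReal_comp
  have he : Set.EqOn (fun t : ℝ => Complex.exp (-s * t) * -s * (backwardRHS lam mu theta m n t : ℂ) +
      Complex.exp (-s * t) *
        ((-q * backwardRHS lam mu theta m n t + inflow lam mu theta m n t : ℝ) : ℂ))
      (fun t => lam * laplaceIntegrand lam mu theta (m + 1) n s t +
        deathRate mu theta m * laplaceIntegrand lam mu theta (m - 1) n s t -
          (s + q) * laplaceIntegrand lam mu theta m n s t) (Set.Ioi 0) := by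
    intro t ht
    simp only [laplaceIntegrand_eq _ _ _ _ _ _ ht,
      ← evenTransition_eq_backwardRHS hlam hmu htheta m n (le_of_lt ht), inflow]
    push_cast
    ring
  have hI₁ : ∀ m, IntegrableOn (fun t => lam * laplaceIntegrand lam mu theta (m + 1) n s t +
      deathRate mu theta m * laplaceIntegrand lam mu theta (m - 1) n s t) (Set.Ioi 0) := fun m =>
    ((hi (m + 1)).const_mul _).add ((hi (m - 1)).const_mul _)
  have hI : IntegrableOn (fun t => lam * laplaceIntegrand lam mu theta (m + 1) n s t +
        deathRate mu theta m * laplaceIntegrand lam mu theta (m - 1) n s t -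
          (s + q) * laplaceIntegrand lam mu theta m n s t) (Set.Ioi 0) :=
    (hI₁ m).sub ((hi m).const_mul _)
  have hlim : Tendsto (fun t : ℝ => Complex.exp (-s * t) * (backwardRHS lam mu theta m n t : ℂ))
      atTop (𝓝 0) := by
    have h1 : Tendsto (fun t => Real.exp (-s.re * t)) atTop (𝓝 0) :=
      Real.tendsto_exp_atBot.comp (tendsto_id.const_mul_atTop_of_neg (neg_neg_of_pos hs))
    refine squeeze_zero_norm' ?_ h1
    filter_upwards [eventually_gt_atTop 0] with t ht
    rw [← evenTransition_eq_backwardRHS hlam hmu htheta m n ht.le,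
      ← laplaceIntegrand_eq _ _ _ _ _ _ ht]
    exact norm_laplaceIntegrand_le hlam hmu htheta m n s ht
  -- Integrating the derivative of `exp (-s t)` times the transition probability over the half-line
  -- leaves minus the initial value, which is the source term.
  have h := integral_Ioi_of_hasDerivAt_of_tendsto (hd 0).continuousAt.continuousWithinAt
    (fun t _ => hd t) ((integrableOn_congr_fun he measurableSet_Ioi).2 hI) hlim
  rw [setIntegral_congr_fun measurableSet_Ioi he, integral_sub (hI₁ m) ((hi m).const_mul _),
    integral_add ((hi (m + 1)).const_mul _) ((hi (m - 1)).const_mul _), integral_const_mul,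
    integral_const_mul, integral_const_mul] at h
  simp only [backwardRHS, intervalIntegral.integral_same, mul_zero, Complex.ofReal_zero,
    Complex.exp_zero, Real.exp_zero, one_mul, add_zero, zero_sub] at h
  simp only [qHat]
  have hδ : (((if m = n then 1 else 0 : ℝ)) : ℂ) = if m = n then 1 else 0 := by
    split_ifs <;> simp
  rw [hδ, hq] at h
  push_cast at h
  linear_combination -h

theorem qHat_ofReal (hlam : 0 < lam) (hmu : 0 < mu) (htheta : 0 < theta) (m n : ℕ) (b : ℝ) :
    qHat lam mu theta m n b = ((∫⁻ t in Set.Ioi 0, survival b t *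
      transition (queueGenerator lam unitSize mu theta) t m n).toReal : ℂ) := by
  have hm := measurable_transition (queueGenerator lam unitSize mu theta) m n
  rw [qHat, ← integral_toReal (by fun_prop), ← integral_complex_ofReal]
  · refine setIntegral_congr_fun measurableSet_Ioi fun t ht => ?_
    simp only [laplaceIntegrand, survival]
    rw [ENNReal.toReal_mul, ENNReal.toReal_ofReal (Real.exp_pos _).le]
    push_cast
    rfl
  · filter_upwards [ae_restrict_mem measurableSet_Ioi] with t ht
    exact ENNReal.mul_lt_top ENNReal.ofReal_lt_top
      ((transition_le_one (isConservative_unitSize hlam hmu htheta) (le_of_lt ht) m n).trans_lt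
        ENNReal.one_lt_top)

end Laplace

/-! ### The volume at the best quote -/

theorem isDistribution_resetLaw {lam0 muA : ℝ} (hlam0 : 0 < lam0) (hmuA : 0 < muA)
    {g0 pi2 : ℕ+ → ℝ} (hg0 : IsDistribution g0) (hpi2 : IsDistribution pi2) :
    IsDistribution (resetLaw lam0 muA g0 pi2) := by
  constructor
  · intro i
    have h1 := hg0.1 i
    have h2 := hpi2.1 i
    unfold resetLaw
    positivity
  · have h := ((hg0.2.mul_left lam0).div_const (lam0 + muA)).add
      ((hpi2.2.mul_left muA).div_const (lam0 + muA))
    rwa [mul_one, mul_one, ← add_div, div_self (by positivity)] at h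

theorem exists_isStationary_bestQuote {lam0 lam1 mu muA theta1 : ℝ} (hlam0 : 0 < lam0)
    (hlam1 : 0 < lam1) (hmu : 0 < mu) (hmuA : 0 < muA) (htheta1 : 0 < theta1) {g0 pi2 : ℕ+ → ℝ}
    (hg0 : IsDistribution g0) (hpi2 : IsDistribution pi2) :
    ∃ π : ℕ+ → ℝ,
      (∀ ν : ℕ+ → ℝ, IsStationary
        (bestQuoteTransition lam0 lam1 mu muA theta1 g0 unitSize pi2) ν ↔ ν = π) ∧
      ∀ j : ℕ+, HasSum
        (fun m : ℕ+ => ((lam0 : ℂ) + muA) * (resetLaw lam0 muA g0 pi2 m *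
          qHat lam1 mu theta1 m.natPred j.natPred (lam0 + muA)))
        (π j : ℂ) := by
  have hb : 0 < lam0 + muA := by positivity
  have hh := isDistribution_resetLaw hlam0 hmuA hg0 hpi2
  have hA := isConservative_unitSize hlam1 hmu htheta1
  have hV := isLyapunov_queueGenerator hlam1 hmu.le htheta1 isDistribution_unitSize
    summable_mul_unitSize
  set P := onePlus (transition (queueGenerator lam1 unitSize mu theta1))
  have hP : ∀ i j, Measurable fun t => P t i j := fun i j => measurable_transition _ _ _
  have hP1 : ∀ t, 0 ≤ t → ∀ i, ∑' j, P t i j = 1 := by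
    intro t ht i
    rw [tsum_pnat]
    simp only [P, onePlus, Nat.natPred_succPNat]
    exact tsum_transition hA hV ht _
  have hadd : ∀ v t, 0 ≤ v → 0 ≤ t → ∀ i j, P (v + t) i j = ∑' k, P v i k * P t k j := by
    intro v t hv ht i j
    rw [tsum_pnat]
    simp only [P, onePlus, Nat.natPred_succPNat]
    exact transition_add _ hv ht _ _
  refine ⟨_, isStationary_resurrectedTransition_iff hb hh hP hP1 hadd, fun j => ?_⟩
  -- The law at an exponential time is `b` times the `h`-mixture of the Laplace transforms at the
  -- real point `b = lam0 + muA`.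
  have h := Complex.hasSum_ofReal.2 (hasSum_ageLaw hb hh hP hP1 j)
  convert h using 2 with m
  rw [← Complex.ofReal_add, qHat_ofReal hlam1 hmu htheta1]
  push_cast
  rfl

end

end OrderBook

theorem mainTheorem4
    (lam0 lam1 lam2 mu muA theta1 theta2 : ℝ)
    (hlam0 : 0 < lam0) (hlam1 : 0 < lam1) (hlam2 : 0 < lam2) (hmu : 0 < mu) (hmuA : 0 < muA)
    (htheta1 : 0 < theta1) (htheta2 : 0 < theta2)
    (g0 : ℕ+ → ℝ) (hg0 : OrderBook.IsDistribution g0) :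
    -- the Laplace transforms exist and are given by convergent continued fractions
    (∀ (m n : ℕ) (s : ℂ), 0 < s.re →
      IntegrableOn (OrderBook.laplaceIntegrand lam1 mu theta1 m n s) (Set.Ioi 0) ∧
      (m ≤ n → Tendsto
        (fun N => (lam1 : ℂ) ^ (n - m) * (OrderBook.fraction lam1 mu theta1 m n s).convs N)
        atTop (𝓝 (OrderBook.qHat lam1 mu theta1 m n s))) ∧
      (n ≤ m → Tendsto
        (fun N => (∏ j ∈ Finset.Icc (n + 1) m, ((mu : ℂ) + j * theta1)) *
          (OrderBook.fraction lam1 mu theta1 n m s).convs N)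
        atTop (𝓝 (OrderBook.qHat lam1 mu theta1 m n s)))) ∧
    -- the stationary distribution of the volume at the best quote
    (∀ pi2 : ℕ+ → ℝ, OrderBook.IsDistribution pi2 →
      ∃ π : ℕ+ → ℝ,
        (∀ ν : ℕ+ → ℝ, OrderBook.IsStationary
          (OrderBook.bestQuoteTransition lam0 lam1 mu muA theta1 g0 OrderBook.unitSize pi2) ν ↔
            ν = π) ∧
        ∀ j : ℕ+, HasSum
          (fun m : ℕ+ => ((lam0 : ℂ) + muA) * (OrderBook.resetLaw lam0 muA g0 pi2 m *
            OrderBook.qHat lam1 mu theta1 m.natPred j.natPred (lam0 + muA)))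
          (π j : ℂ)) ∧
    -- unit-sized limit orders inside the book
    (∃ pi2 : ℕ+ → ℝ,
      (∀ ν : ℕ+ → ℝ, OrderBook.IsStationary
        (OrderBook.secondLimitTransition lam2 OrderBook.unitSize theta2) ν ↔ ν = pi2) ∧
      ∀ i : ℕ+, OrderBook.resetLaw lam0 muA g0 pi2 i =
        lam0 * g0 i / (muA + lam0) + muA / (muA + lam0) *
          (Real.exp (-(lam2 / theta2)) * lam2 ^ i.natPred /
            (theta2 ^ i.natPred * (i.natPred)!))) ∧
    -- geometrically distributed limit orders inside the book
    (∀ q2 : ℝ, 0 < q2 → q2 < 1 →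
      ∃ pi2 : ℕ+ → ℝ,
        (∀ ν : ℕ+ → ℝ, OrderBook.IsStationary
          (OrderBook.secondLimitTransition lam2 (OrderBook.geometricSize q2) theta2) ν ↔
            ν = pi2) ∧
        ∀ i : ℕ+, OrderBook.resetLaw lam0 muA g0 pi2 i =
          lam0 * g0 i / (muA + lam0) + muA / (muA + lam0) *
            (q2 ^ (lam2 / ((1 - q2) * theta2)) *
              ((1 - q2) ^ i.natPred / (i.natPred)!) *
              (Real.Gamma (i.natPred + lam2 / ((1 - q2) * theta2)) /
                Real.Gamma (lam2 / ((1 - q2) * theta2))))) := by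
  refine ⟨fun m n s hs => ?_, fun pi2 hpi2 =>
    OrderBook.exists_isStationary_bestQuote hlam0 hlam1 hmu hmuA htheta1 hg0 hpi2, ?_, ?_⟩
  · have hm := OrderBook.isResolvent_qHat hlam1 hmu htheta1 m hs
    have hn := OrderBook.isResolvent_qHat hlam1 hmu htheta1 n hs
    have hC := fun n m => OrderBook.norm_qHat_le hlam1 hmu htheta1 m n hs
    exact ⟨OrderBook.integrableOn_laplaceIntegrand hlam1 hmu htheta1 m n hs,
      hn.tendsto_convs hlam1 hmu htheta1 hs (hC n),
      hm.tendsto_convs_of_ge hlam1 hmu htheta1 hs hn (hC m) (hC n)⟩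
  · refine ⟨_, OrderBook.isStationary_secondLimit_unitSize_iff hlam2 htheta2, fun i => ?_⟩
    rw [OrderBook.resetLaw, OrderBook.poissonWeight, div_pow]
    field_simp
    ring
  · intro q hq hq1
    refine ⟨_, OrderBook.isStationary_secondLimit_geometricSize_iff hlam2 htheta2 hq hq1,
      fun i => ?_⟩
    rw [OrderBook.resetLaw, OrderBook.negBinomialWeight, add_comm lam0 muA]
    ring
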